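/- Let $n,k\ge 0$ and $N=n+k$. Write $x\oplus y=x+y+\beta xy$, $x\ominus y=\frac{x-y}{1+\beta y}$ and $\ominus y=0\ominus y$. Let $\mathcal R(\mathbb T)$ be the ring of rational functions in $\beta,t_1,\dots,t_N$ that are regular at $\beta=0$ and at $\beta=-1$ (fractions whose denominator vanishes identically neither at $\beta=0$ nor at $\beta=-1$), and let $\mathcal R(\mathbb T,q)=\mathcal R(\mathbb T)[\![q]\!]$. The symmetric group $\mathbb S_N$ acts on both rings by permuting $t_1,\dots,t_N$; $s_j$ denotes the transposition $(j\;\,j+1)$, $1\le j\le N-1$. A boxed partition $\lambda\subset(k^n)$ is a sequence $k\ge\lambda_1\ge\dots\ge\lambda_n\ge 0$; it is identified with the 01-word of length $N$ whose one-letters are at the positions $I_\lambda=\{\lambda_{n+1-i}+i : 1\le i\le n\}$, and $s_j\lambda$ is obtained by exchanging the letters $j$ and $j+1$. For such $\lambda$ let $$G_\lambda(x_1,\dots,x_n|a)=\sum_T\beta^{|T|-|\lambda|}\prod_{(i,j)\in\lambda}\ \prod_{r\in T(i,j)}x_r\oplus a_{r+j-i}$$ be the factorial Grothendieck polynomial,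 the sum running over all set-valued tableaux $T$ of shape $\lambda$ with entries in $\{1,\dots,n\}$ (a nonempty set $T(i,j)$ in each cell, with $\max T(i,j)\le\min T(i,j+1)$ and $\max T(i,j)<\min T(i+1,j)$), where $|T|=\sum_{(i,j)}|T(i,j)|$. Put $t_m=0$ unless $1\le m\le N$. (Bethe roots.) For each $\mu\subset(k^n)$ there is exactly one tuple $y_\mu=(y_1,\dots,y_n)\in\mathcal R(\mathbb T,q)^n$ with $y_i=t_{\mu_{n+1-i}+i}+O(q)$ which solves the Bethe ansatz equations $$(-1)^n\frac{\prod_{l=1}^n(1+\beta y_l)}{(1+\beta y_i)^n}\prod_{j=1}^N(y_i\ominus t_j)+q=0,\qquad i=1,\dots,n.$$ Define the localised Schubert classes $[\mathcal O_\lambda]=([\mathcal O_\lambda]_\mu)_{\mu\subset(k^n)}\in\mathcal R(\mathbb T,q)^{\binom Nn}$ by $[\mathcal O_\lambda]_\mu=G_\lambda(y_\mu|\ominus t)$, and let $\mathbb S_N$ act on sequences $f=(f_\mu)_{\mu\subset(k^n)}$ by $(\boldsymbol w f)_\mu=w(f_{w^{-1}\mu})$, so that $(\boldsymbol s_jf)_\mu=s_j(f_{s_j\mu})$.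 (GKM condition.) For all $\lambda\subset(k^n)$ and $1\le j\le N-1$, $$\boldsymbol s_j[\mathcal O_\lambda]-[\mathcal O_\lambda]=(t_j\ominus t_{j+1})\,\delta_j^*[\mathcal O_\lambda],\qquad \delta_j^*[\mathcal O_\lambda]=\begin{cases}\beta[\mathcal O_\lambda]+[\mathcal O_{s_j\lambda}],& j\notin I_\lambda,\ j+1\in I_\lambda,\\ 0,&\text{otherwise.}\end{cases}$$ (Braid matrices.) Let $\mathcal V_n^q$ be the free $\mathcal R(\mathbb T,q)$-module with basis $\{v_\lambda\}_{\lambda\subset(k^n)}$, let $\hat r_j$ be the $\mathcal R(\mathbb T,q)$-linear endomorphism with $\hat r_jv_\lambda=(1+\beta(t_{j+1}\ominus t_j))v_\lambda+(t_{j+1}\ominus t_j)v_{s_j\lambda}$ if $j\notin I_\lambda$, $j+1\in I_\lambda$, and $\hat r_jv_\lambda=v_\lambda$ otherwise, and let $s_j\otimes 1$ act on the coefficients in the basis $\{v_\lambda\}$. Then the $\mathcal R(\mathbb T,q)$-linear map $\mathcal V_n^q\to\mathcal R(\mathbb T,q)^{\binom Nn}$, $v_\lambda\mapsto[\mathcal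 O_\lambda]$, intertwines $(s_j\otimes 1)\hat r_j$ with $\boldsymbol s_j$ for $1\le j\le N-1$. -/

import Mathlib

namespace BetheGKM

noncomputable section

/-! ## Boxed partitions, 01-words and the action of the symmetric group -/

/-- A boxed partition: at most `n` parts `p 0 ≥ p 1 ≥ …`, each at most `k`. -/
@[ext]
structure BoxedPartition (n k : ℕ) where
  part : Fin n → ℕ
  anti : Antitone part
  le_box : ∀ i, part i ≤ k

namespace BoxedPartition

variable {n k : ℕ}

/-- The increasing sequence of positions of the one-letters in the 01-word of length `n + k` of a
boxed partition: `w(i) = λ_{n+1-i} + i` for `i = 1, …, n`, written with indices that start at 0. -/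
def position (p : BoxedPartition n k) : Fin n ↪o Fin (n + k) :=
  OrderEmbedding.ofStrictMono
    (fun i => ⟨p.part i.rev + i, by have := p.le_box i.rev; have := i.isLt; omega⟩)
    (fun i j hij => by
      have h1 : p.part i.rev ≤ p.part j.rev := p.anti (Fin.rev_le_rev.mpr hij.le)
      have h2 : (i : ℕ) < j := hij
      simp only [Fin.mk_lt_mk]
      omega)

theorem position_val (p : BoxedPartition n k) (i : Fin n) :
    (p.position i : ℕ) = p.part i.rev + i := rfl

theorem val_le_of_strictMono (w : Fin n ↪o Fin (n + k)) {i j : Fin n} (hij : i ≤ j) :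
    (w i : ℕ) + j ≤ w j + i := by
  obtain ⟨d, hd⟩ : ∃ d : ℕ, (j : ℕ) = i + d := ⟨j - i, by have : (i : ℕ) ≤ j := hij; omega⟩
  induction d generalizing j with
  | zero =>
    have : j = i := Fin.ext (by omega)
    subst this; rfl
  | succ d ih =>
    have hlt : (i : ℕ) + d < n := by have := j.isLt; omega
    have h1 := ih (j := ⟨i + d, hlt⟩) (Fin.mk_le_mk.mpr (by simp)) rfl
    have h2 : w ⟨i + d, hlt⟩ < w j := w.strictMono (Fin.lt_def.mpr (by simp; omega))
    have h3 : (w ⟨i + d, hlt⟩ : ℕ) < w j := h2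
    simp only at h1
    omega

theorem le_val_of_strictMono (w : Fin n ↪o Fin (n + k)) (i : Fin n) : (i : ℕ) ≤ w i := by
  have h := val_le_of_strictMono w (i := ⟨0, i.pos⟩) (j := i) (Fin.mk_le_mk.mpr (by simp))
  simp only at h
  omega

theorem val_le_add_of_strictMono (w : Fin n ↪o Fin (n + k)) (i : Fin n) : (w i : ℕ) ≤ i + k := by
  have hn := i.isLt
  have h := val_le_of_strictMono w (i := i) (j := ⟨n - 1, by omega⟩)
    (Fin.mk_le_mk.mpr (by omega))
  have h2 := (w ⟨n - 1, by omega⟩).isLt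
  simp only at h
  omega

/-- Boxed partitions correspond to increasing sequences of positions. -/
def positionEquiv (n k : ℕ) : BoxedPartition n k ≃ (Fin n ↪o Fin (n + k)) where
  toFun := position
  invFun w :=
    { part := fun i => (w i.rev : ℕ) - i.rev
      anti := fun i j hij => by
        have h := val_le_of_strictMono w (Fin.rev_le_rev.mpr hij)
        have := le_val_of_strictMono w i.rev
        have := le_val_of_strictMono w j.rev
        simp only
        omega
      le_box := fun i => by
        have := val_le_add_of_strictMono w i.rev
        omega }
  left_inv p := by
    ext i
    simp only [position_val, Fin.rev_rev]
    omega
  right_inv w := by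
    ext i
    have := le_val_of_strictMono w i
    simp only [position_val, Fin.rev_rev]
    omega

/-- Boxed partitions correspond to 01-words of length `n + k` with `n` one-letters, the latter
given by the `n`-element set of positions of their one-letters. -/
def wordEquiv (n k : ℕ) : BoxedPartition n k ≃ Set.powersetCard (Fin (n + k)) n :=
  (positionEquiv n k).trans Set.powersetCard.ofFinEmbEquiv

/-- The set of positions of the one-letters in the 01-word of a boxed partition. -/
def ones (p : BoxedPartition n k) : Finset (Fin (n + k)) := (wordEquiv n k p : Finset _)

/-- The action of the symmetric group on boxed partitions, by permuting the letters of 01-words. -/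
instance : MulAction (Equiv.Perm (Fin (n + k))) (BoxedPartition n k) where
  smul w p := (wordEquiv n k).symm (w • wordEquiv n k p)
  one_smul p := by
    change (wordEquiv n k).symm ((1 : Equiv.Perm (Fin (n + k))) • wordEquiv n k p) = p
    simp
  mul_smul v w p := by
    change (wordEquiv n k).symm ((v * w) • wordEquiv n k p) =
      (wordEquiv n k).symm (v • wordEquiv n k ((wordEquiv n k).symm (w • wordEquiv n k p)))
    simp [mul_smul]

end BoxedPartition

/-- The simple transposition exchanging the positions `j` and `j + 1` (counted from 0). -/
def simpleSwap {N : ℕ} (j : ℕ) (hj : j + 1 < N) : Equiv.Perm (Fin N) :=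
  Equiv.swap ⟨j, by omega⟩ ⟨j + 1, hj⟩

/-! ## The coefficient rings -/

/-- Setting `β = c` in a polynomial in `t_1, …, t_N` over `ℤ[β]`. -/
def specialise (N : ℕ) (c : ℤ) :
    MvPolynomial (Fin N) (Polynomial ℤ) →+* MvPolynomial (Fin N) ℤ :=
  MvPolynomial.map (Polynomial.evalRingHom c)

/-- The polynomials in `β, t_1, …, t_N` that vanish identically neither at `β = 0` nor at
`β = -1`. -/
def regularDenominators (N : ℕ) : Submonoid (MvPolynomial (Fin N) (Polynomial ℤ)) :=
  (nonZeroDivisors (MvPolynomial (Fin N) ℤ)).comap (specialise N 0) ⊓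
    (nonZeroDivisors (MvPolynomial (Fin N) ℤ)).comap (specialise N (-1))

/-- The ring of rational functions in `β, t_1, …, t_N` which are regular at `β = 0` and at
`β = -1`. -/
abbrev EquivRing (N : ℕ) : Type := Localization (regularDenominators N)

/-- Formal power series in `q` over the ring of rational functions. -/
abbrev QuantumRing (N : ℕ) : Type := PowerSeries (EquivRing N)

/-- The parameter `β` in the ring of rational functions. -/
def betaCoeff (N : ℕ) : EquivRing N :=
  algebraMap (MvPolynomial (Fin N) (Polynomial ℤ)) (EquivRing N) (MvPolynomial.C Polynomial.X)

/-- The equivariant parameters in the ring of rational functions. -/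
def tCoeff {N : ℕ} (i : Fin N) : EquivRing N :=
  algebraMap (MvPolynomial (Fin N) (Polynomial ℤ)) (EquivRing N) (MvPolynomial.X i)

/-- The parameter `β` as a constant power series in `q`. -/
def β (N : ℕ) : QuantumRing N := PowerSeries.C (betaCoeff N)

/-- The equivariant parameters as constant power series in `q`. -/
def t {N : ℕ} (i : Fin N) : QuantumRing N := PowerSeries.C (tCoeff i)

/-- The bi-infinite parameter sequence `(t_m)` with `t_m = 0` unless `1 ≤ m ≤ N`; here the index
`m` starts at 1, so that `t_m` is `t` at position `m - 1`. -/
def tSeq (N : ℕ) (m : ℤ) : QuantumRing N :=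
  if h : 1 ≤ m ∧ m ≤ N then t ⟨(m - 1).toNat, by omega⟩ else 0

/-- The denominators in `x ⊖ t_i` are units. -/
theorem isUnit_one_add_beta_mul_t {N : ℕ} (i : Fin N) : IsUnit (1 + β N * t i) := by
  have h : (1 + MvPolynomial.C Polynomial.X * MvPolynomial.X i :
      MvPolynomial (Fin N) (Polynomial ℤ)) ∈ regularDenominators N := by
    simp only [regularDenominators, Submonoid.mem_inf, Submonoid.mem_comap,
      mem_nonZeroDivisors_iff_ne_zero, specialise]
    constructor <;> intro h0 <;>
      simpa using congrArg (MvPolynomial.eval (fun _ => (0 : ℤ))) h0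
  have h2 := (IsLocalization.map_units (EquivRing N) (⟨_, h⟩ : regularDenominators N)).map
    (PowerSeries.C (R := EquivRing N))
  simpa [β, t, betaCoeff, tCoeff] using h2

theorem specialise_rename {N : ℕ} (c : ℤ) (w : Equiv.Perm (Fin N))
    (p : MvPolynomial (Fin N) (Polynomial ℤ)) :
    specialise N c (MvPolynomial.rename w p) = MvPolynomial.rename w (specialise N c p) :=
  MvPolynomial.map_rename _ _ _

theorem rename_ne_zero {N : ℕ} (w : Equiv.Perm (Fin N)) {p : MvPolynomial (Fin N) ℤ}
    (hp : p ≠ 0) : MvPolynomial.rename w p ≠ 0 := fun h =>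
  hp (MvPolynomial.rename_injective w w.injective (by rw [h, map_zero]))

theorem regularDenominators_le {N : ℕ} (w : Equiv.Perm (Fin N)) :
    regularDenominators N ≤ (regularDenominators N).comap
      (MvPolynomial.rename w : MvPolynomial (Fin N) (Polynomial ℤ) →ₐ[Polynomial ℤ] _).toRingHom := by
  intro p hp
  simp only [regularDenominators, Submonoid.mem_inf, Submonoid.mem_comap,
    mem_nonZeroDivisors_iff_ne_zero] at hp ⊢
  refine ⟨?_, ?_⟩
  · have := rename_ne_zero w hp.1
    rwa [← specialise_rename] at this
  · have := rename_ne_zero w hp.2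
    rwa [← specialise_rename] at this

/-- The action of the symmetric group on rational functions by permuting `t_1, …, t_N`. -/
def permCoeff (N : ℕ) : Equiv.Perm (Fin N) →* (EquivRing N →+* EquivRing N) where
  toFun w := IsLocalization.map (EquivRing N)
    (MvPolynomial.rename w : MvPolynomial (Fin N) (Polynomial ℤ) →ₐ[Polynomial ℤ] _).toRingHom
    (regularDenominators_le w)
  map_one' := by
    apply IsLocalization.ringHom_ext (regularDenominators N)
    ext x <;> simp
  map_mul' v w := by
    apply IsLocalization.ringHom_ext (regularDenominators N)
    ext x <;> simp

/-- The action of the symmetric group on power series in `q`, coefficient by coefficient. -/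
def permSeries (N : ℕ) (w : Equiv.Perm (Fin N)) : QuantumRing N →+* QuantumRing N :=
  PowerSeries.map (permCoeff N w)

/-- The action of the symmetric group on sequences indexed by boxed partitions:
`(w • f)_μ = w (f_{w⁻¹ μ})`. -/
def permSeq (n k : ℕ) : Equiv.Perm (Fin (n + k)) →*
    ((BoxedPartition n k → QuantumRing (n + k)) →+* (BoxedPartition n k → QuantumRing (n + k))) where
  toFun w := RingHom.pi fun μ => (permSeries (n + k) w).comp (Pi.evalRingHom _ (w⁻¹ • μ))
  map_one' := by
    ext f μ m
    change PowerSeries.coeff m (permSeries (n + k) 1 (f ((1 : Equiv.Perm (Fin (n + k)))⁻¹ • μ))) = _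
    simp [permSeries]
  map_mul' v w := by
    ext f μ m
    change PowerSeries.coeff m (permSeries (n + k) (v * w) (f ((v * w)⁻¹ • μ))) =
      PowerSeries.coeff m (permSeries (n + k) v (permSeries (n + k) w (f (w⁻¹ • v⁻¹ • μ))))
    simp [permSeries, mul_smul]

theorem permSeq_simpleSwap_apply {n k : ℕ} (j : ℕ) (hj : j + 1 < n + k)
    (f : BoxedPartition n k → QuantumRing (n + k)) (μ : BoxedPartition n k) :
    permSeq n k (simpleSwap j hj) f μ =
      permSeries (n + k) (simpleSwap j hj) (f (simpleSwap j hj • μ)) := by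
  change permSeries (n + k) (simpleSwap j hj) (f ((simpleSwap j hj)⁻¹ • μ)) = _
  simp [simpleSwap]

/-! ## Formal group law and factorial Grothendieck polynomials -/

section Grothendieck

variable {A : Type*} [CommRing A]

/-- `x ⊕ y = x + y + b x y`. -/
def oplus (b x y : A) : A := x + y + b * x * y

/-- `x ⊖ y = (x - y) / (1 + b y)`; it is only used where `1 + b y` is a unit. -/
def ominus (b x y : A) : A := (x - y) * Ring.inverse (1 + b * y)

/-- Set-valued tableaux of shape `shape` with entries in `{1, …, n}` (counted from 0): nonempty
sets, weakly increasing along rows and strictly increasing down columns. -/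
structure IsSetValuedTableau {n : ℕ} (shape : Fin n → ℕ)
    (T : (i : Fin n) → Fin (shape i) → Finset (Fin n)) : Prop where
  nonempty : ∀ i c, (T i c).Nonempty
  row : ∀ (i : Fin n) (c d : Fin (shape i)), (c : ℕ) + 1 = d →
    ∀ a ∈ T i c, ∀ b ∈ T i d, a ≤ b
  column : ∀ (i j : Fin n) (c : Fin (shape i)) (d : Fin (shape j)), (i : ℕ) + 1 = j →
    (c : ℕ) = d → ∀ a ∈ T i c, ∀ b ∈ T j d, a < b

open scoped Classical in
/-- The factorial Grothendieck polynomial `G(x|a)` of a partition, the sum over all set-valued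
tableaux `T` of `b ^ (|T| - |shape|) ∏ x_r ⊕ a_{r+j-i}`, the product being over all cells `(i, j)`
and all `r` in `T(i, j)`. As `r`, `i`, `j` are counted from 0 here and the sequence `a` is not
shifted, the index of `a` becomes `r + j - i + 1`. -/
def factorialG {n : ℕ} (b : A) (shape : Fin n → ℕ) (x : Fin n → A) (a : ℤ → A) : A :=
  ∑ T : (i : Fin n) → Fin (shape i) → Finset (Fin n) with IsSetValuedTableau shape T,
    b ^ ((∑ i, ∑ c, (T i c).card) - ∑ i, shape i) *
      ∏ i : Fin n, ∏ c : Fin (shape i), ∏ r ∈ T i c,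
        oplus b (x r) (a ((r : ℤ) + (c : ℤ) - (i : ℤ) + 1))

end Grothendieck

/-! ## Bethe roots and localised Schubert classes -/

/-- `y` is the tuple of Bethe roots with label `μ`: it solves the Bethe ansatz equations
`(-1)^n Π(y) / (1 + β y_i)^n ∏_j (y_i ⊖ t_j) + q = 0`, where `Π(y) = ∏_l (1 + β y_l)`, and
the constant term of the `i`-th root is the parameter `t` at the `i`-th one-letter of `μ`. -/
structure IsBetheRoot {n k : ℕ} (μ : BoxedPartition n k) (y : Fin n → QuantumRing (n + k)) :
    Prop where
  bethe : ∀ i, (-1) ^ n * (∏ l, (1 + β (n + k) * y l)) *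
    Ring.inverse (1 + β (n + k) * y i) ^ n * (∏ j, ominus (β (n + k)) (y i) (t j)) +
      PowerSeries.X = 0
  constant : ∀ i, PowerSeries.constantCoeff (y i) = tCoeff (μ.position i)

/-- The localised Schubert class of `p`, as a sequence indexed by boxed partitions `μ`, with
respect to the tuples `y μ`: its entries are `G_p(y_μ | ⊖ t)`. -/
def schubertClass {n k : ℕ} (y : BoxedPartition n k → Fin n → QuantumRing (n + k))
    (p : BoxedPartition n k) : BoxedPartition n k → QuantumRing (n + k) :=
  fun μ => factorialG (β (n + k)) p.part (y μ) (fun m => ominus (β (n + k)) 0 (tSeq (n + k) m))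

open scoped Classical in
/-- The generalised difference operator on localised Schubert classes. -/
def deltaStar {n k : ℕ} (y : BoxedPartition n k → Fin n → QuantumRing (n + k)) (j : ℕ)
    (hj : j + 1 < n + k) (p : BoxedPartition n k) : BoxedPartition n k → QuantumRing (n + k) :=
  if (⟨j, by omega⟩ : Fin (n + k)) ∉ p.ones ∧ (⟨j + 1, hj⟩ : Fin (n + k)) ∈ p.ones then
    β (n + k) • schubertClass y p + schubertClass y (simpleSwap j hj • p)
  else 0

/-! ## The action of the symmetric group through braid matrices -/

/-- The weight space with `n` one-letters of the quantum space over power series in `q`, with its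
spin basis `Finsupp.single p 1`. -/
abbrev SpinSpace (n k : ℕ) : Type := BoxedPartition n k →₀ QuantumRing (n + k)

open scoped Classical in
/-- The braid matrix at the tensor factors `j`, `j + 1`. -/
def braid {n k : ℕ} (j : ℕ) (hj : j + 1 < n + k) :
    SpinSpace n k →ₗ[QuantumRing (n + k)] SpinSpace n k :=
  Finsupp.linearCombination (QuantumRing (n + k)) fun p =>
    if (⟨j, by omega⟩ : Fin (n + k)) ∉ p.ones ∧ (⟨j + 1, hj⟩ : Fin (n + k)) ∈ p.ones then
      Finsupp.single p
        (1 + β (n + k) * ominus (β (n + k)) (t ⟨j + 1, hj⟩) (t ⟨j, by omega⟩)) +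
      Finsupp.single (simpleSwap j hj • p)
        (ominus (β (n + k)) (t ⟨j + 1, hj⟩) (t ⟨j, by omega⟩))
    else Finsupp.single p 1

/-- The braid matrix followed by the simple transposition acting on coefficients. -/
def braidAction {n k : ℕ} (j : ℕ) (hj : j + 1 < n + k) (v : SpinSpace n k) : SpinSpace n k :=
  (braid j hj v).mapRange (permSeries (n + k) (simpleSwap j hj)) (map_zero _)

/-- The linear map which sends each vector of the spin basis to its localised Schubert class. -/
def localise {n k : ℕ} (y : BoxedPartition n k → Fin n → QuantumRing (n + k)) :
    SpinSpace n k →ₗ[QuantumRing (n + k)] (BoxedPartition n k → QuantumRing (n + k)) :=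
  Finsupp.linearCombination (QuantumRing (n + k)) (schubertClass y)

end

end BetheGKM

/-! Everything rests on the bialternant formula `det_powerMatrix`: the Vandermonde product times
`G_λ(x|a)` is the determinant with entries `(1 + b x_i)^j [x_i|α]^{e_j}`, where `e_j = λ_j + n - 1 -
j` (rows and columns counted from 0) and `α_q = a_{q+1}`. It is proved by induction on the number of
variables, because both sides obey the same branching rule: for the determinant by column operations
and expansion along the last row (`det_bialternant_succ`), for tableaux by removing the largest
entry (`boxedG_succ`).

The exponents `e_j` are the positions of the one-letters, so the determinant shows what an exchange
of `α_j` and `α_{j+1}` does: only a column with exponent `j + 1` can change. If `j` is an exponent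
too, the change is a multiple of the neighbouring column and the determinant stays the same. If not,
the change, multiplied by `1 + b α_j`, combines the old column with the column of exponent `j`, that
is, `G_λ` with `G_{s_j λ}`.

The Bethe equations have the form `y_i = t - q / unit`, a contraction for the `q`-adic topology, so
the constant terms determine a unique solution (`existsUnique_bethe_solution`). The equations are
symmetric in `t`; by uniqueness `w` maps `y_μ` to `y_{wμ}` up to order, and the order is irrelevant
since `G_λ` is symmetric in `x`. Hence `s_j` acts on a localised class only by exchanging `t_j` and
`t_{j+1}` among the parameters (`permSeries_schubertClass`), and the determinant identity becomes
the GKM condition. The statement on braid matrices is its semilinear extension from the basis. -/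

namespace BetheGKM

noncomputable section

/-! ## The bialternant -/

section Bialternant

variable {A : Type*} [CommRing A]

/-- The factorial power `(x ⊕ α_0) ⋯ (x ⊕ α_{p-1})`. -/
def factorialPower (b x : A) (α : ℕ → A) (p : ℕ) : A :=
  ∏ q ∈ Finset.range p, oplus b x (α q)

/-- The matrix in the numerator of the bialternant formula for the partition `l` with `m` parts. -/
def bialternant (b : A) (m : ℕ) (l : ℕ → ℕ) (x α : ℕ → A) : Matrix (Fin m) (Fin m) A :=
  Matrix.of fun i j =>
    (1 + b * x i) ^ (j : ℕ) * factorialPower b (x i) α (l j + (m - 1 - j))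

/-- The Vandermonde product `∏_{i < j < m} (x_i - x_j)`. -/
def vandermondeProd (m : ℕ) (x : ℕ → A) : A :=
  ∏ j ∈ Finset.range m, ∏ i ∈ Finset.range j, (x i - x j)

/-- The weight of a row in the branching rule: the row is shortened from `M` to `μ` cells, where
`L` is the length of the next row. -/
def branchWeight (b z : A) (α : ℕ → A) (d L M μ : ℕ) : A :=
  (∏ c ∈ Finset.Ico μ M, oplus b z (α (c + d + 1))) *
    if μ = L then 1 else 1 + b * oplus b z (α (μ + d))

theorem factorialPower_succ (b x : A) (α : ℕ → A) (p : ℕ) :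
    factorialPower b x α (p + 1) = factorialPower b x α p * oplus b x (α p) :=
  Finset.prod_range_succ _ _

theorem factorialPower_sub (b x z : A) (α : ℕ → A) (d : ℕ) {L M : ℕ} (h : L ≤ M) :
    (1 + b * z) * factorialPower b x α (M + d + 1) -
        (1 + b * x) * factorialPower b x α (L + d) *
          ∏ q ∈ Finset.Ico (L + d) (M + d + 1), oplus b z (α q) =
      (x - z) * ∑ μ ∈ Finset.Icc L M,
        branchWeight b z α d L M μ * factorialPower b x α (μ + d) := by
  induction M, h using Nat.le_induction with
  | base =>
    simp only [factorialPower_succ, Nat.Ico_succ_singleton, Finset.prod_singleton,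
      Finset.Icc_self, Finset.sum_singleton, branchWeight, Finset.Ico_self, Finset.prod_empty,
      if_true, oplus]
    ring
  | succ M h ih =>
    have h1 : ∀ μ ∈ Finset.Icc L M, branchWeight b z α d L (M + 1) μ *
        factorialPower b x α (μ + d) = oplus b z (α (M + d + 1)) *
        (branchWeight b z α d L M μ * factorialPower b x α (μ + d)) := by
      intro μ hμ
      rw [branchWeight, branchWeight, Finset.prod_Ico_succ_top (Finset.mem_Icc.1 hμ).2]
      ring
    rw [← Finset.insert_Icc_right_eq_Icc_add_one (by omega), Finset.sum_insert (by simp),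
      Finset.sum_congr rfl h1, ← Finset.mul_sum,
      show M + 1 + d + 1 = M + d + 1 + 1 by ring, factorialPower_succ,
      Finset.prod_Ico_succ_top (by omega : L + d ≤ M + d + 1), branchWeight,
      if_neg (by omega : M + 1 ≠ L), show M + 1 + d = M + d + 1 by ring]
    simp only [Finset.Ico_self, Finset.prod_empty]
    have h2 : oplus b x (α (M + d + 1)) - oplus b z (α (M + d + 1)) =
      (x - z) * (1 + b * α (M + d + 1)) := by simp only [oplus]; ring
    have h3 : (1 + b * z) * (1 + b * α (M + d + 1)) = 1 + b * oplus b z (α (M + d + 1)) := by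
      simp only [oplus]; ring
    linear_combination oplus b z (α (M + d + 1)) * ih +
      (1 + b * z) * factorialPower b x α (M + d + 1) * h2 +
      (x - z) * factorialPower b x α (M + d + 1) * h3

theorem det_sum_col {m : ℕ} {κ : Type*} [DecidableEq κ] (S : Fin m → Finset κ) (c : Fin m → κ → A)
    (g : Fin m → κ → Fin m → A) :
    (Matrix.of fun i j => ∑ μ ∈ S j, c j μ * g j μ i).det =
      ∑ μ ∈ Fintype.piFinset S, (∏ j, c j (μ j)) * (Matrix.of fun i j => g j (μ j) i).det := by
  have key := (Matrix.detRowAlternating (R := A) (n := Fin m)).toMultilinearMap.map_sum_finset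
    (fun j μ => c j μ • g j μ) S
  rw [← Matrix.det_transpose]
  have e : (Matrix.of fun i j => ∑ μ ∈ S j, c j μ * g j μ i).transpose =
      fun j => ∑ μ ∈ S j, c j μ • g j μ := by
    ext j i
    simp [Finset.sum_apply]
  rw [e]
  refine key.trans (Finset.sum_congr rfl fun μ _ => ?_)
  rw [MultilinearMap.map_smul_univ, smul_eq_mul]
  congr 1
  rw [← Matrix.det_transpose]
  rfl

theorem det_eq_of_last_row {m : ℕ} (B : Matrix (Fin (m + 1)) (Fin (m + 1)) A)
    (h : ∀ j : Fin m, B (Fin.last m) j.castSucc = 0) :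
    B.det = B (Fin.last m) (Fin.last m) * (B.submatrix Fin.castSucc Fin.castSucc).det := by
  rw [Matrix.det_succ_row B (Fin.last m), Fin.sum_univ_castSucc, Finset.sum_eq_zero]
  · simp [← two_mul, Fin.succAbove_last]
  · intro j _
    simp [h]

/-- Reversing rows and columns turns multiples of the next column into multiples of the previous
one. -/
theorem det_eq_of_col_sub_succ {m : ℕ} {F B : Matrix (Fin (m + 1)) (Fin (m + 1)) A} (c : Fin m → A)
    (hlast : ∀ i, F i (Fin.last m) = B i (Fin.last m))
    (h : ∀ i (j : Fin m), F i j.castSucc = B i j.castSucc + c j * F i j.succ) :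
    F.det = B.det := by
  rw [← Matrix.det_submatrix_equiv_self Fin.revPerm F,
    ← Matrix.det_submatrix_equiv_self Fin.revPerm B]
  refine Matrix.det_eq_of_forall_col_eq_smul_add_pred (fun j => c j.rev) ?_ ?_
  · intro i
    simpa using hlast i.rev
  · intro i j
    simpa [Fin.rev_succ, Fin.rev_castSucc] using h i.rev j.rev

/-- Extension of a finite sequence by zero. -/
def extendZero {m : ℕ} {M : Type*} [Zero M] (f : Fin m → M) (i : ℕ) : M :=
  if h : i < m then f ⟨i, h⟩ else 0

@[simp]
theorem extendZero_val {m : ℕ} {M : Type*} [Zero M] (f : Fin m → M) (i : Fin m) :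
    extendZero f i = f i := by
  simp [extendZero]

theorem extendZero_of_le {m : ℕ} {M : Type*} [Zero M] (f : Fin m → M) {i : ℕ} (h : m ≤ i) :
    extendZero f i = 0 := by
  simp [extendZero, not_lt.2 h]

/-- Subtracting from each column a multiple of the next one clears the last row except for its
corner. In the remaining minor, row `i` has the factor `x_i - x_m`, and by `factorialPower_sub`
every column is a sum over row lengths interlacing with `l`; multilinearity of the determinant then
gives the sum over `μ`. -/
theorem det_bialternant_succ (b : A) (m : ℕ) {l : ℕ → ℕ} (hl : Antitone l) (x α : ℕ → A)
    (hu : IsUnit (1 + b * x m)) :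
    (bialternant b (m + 1) l x α).det =
      (∏ i ∈ Finset.range m, (x i - x m)) *
        ∑ μ ∈ Fintype.piFinset fun i : Fin m => Finset.Icc (l (i + 1)) (l i),
          (∏ i : Fin m, branchWeight b (x m) α (m - 1 - i) (l (i + 1)) (l i) (μ i)) *
            factorialPower b (x m) α (l m) * (bialternant b m (extendZero μ) x α).det := by
  obtain ⟨u, hu⟩ := hu.exists_left_inv
  set z := x m with hz
  -- The multiplier that makes column `j` minus `k j` times column `j + 1` vanish at `x_i = z`. It
  -- divides by `1 + b z`, hence the unit hypothesis.
  set k : Fin m → A := fun j => u * ∏ q ∈ Finset.Ico (l (j + 1) + (m - 1 - j))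
    (l j + (m - 1 - j) + 1), oplus b z (α q) with hk
  set F := bialternant b (m + 1) l x α with hF
  set B : Matrix (Fin (m + 1)) (Fin (m + 1)) A := Matrix.of fun i =>
    Fin.lastCases (F i (Fin.last m)) fun j => F i j.castSucc - k j * F i j.succ with hB
  have hBval : ∀ (i : Fin (m + 1)) (j : Fin m), B i j.castSucc =
      u * (x i - z) * ∑ μ ∈ Finset.Icc (l (j + 1)) (l j),
        branchWeight b z α (m - 1 - j) (l (j + 1)) (l j) μ *
          ((1 + b * x i) ^ (j : ℕ) * factorialPower b (x i) α (μ + (m - 1 - j))) := by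
    intro i j
    have h1 := factorialPower_sub b (x i) z α (m - 1 - j) (hl (by omega : (j : ℕ) ≤ j + 1))
    have h2 : B i j.castSucc = F i j.castSucc - k j * F i j.succ := by simp [hB]
    have h3 : ∑ μ ∈ Finset.Icc (l (j + 1)) (l j),
        branchWeight b z α (m - 1 - j) (l (j + 1)) (l j) μ *
          ((1 + b * x i) ^ (j : ℕ) * factorialPower b (x i) α (μ + (m - 1 - j))) =
        (1 + b * x i) ^ (j : ℕ) * ∑ μ ∈ Finset.Icc (l (j + 1)) (l j),
        branchWeight b z α (m - 1 - j) (l (j + 1)) (l j) μ *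
          factorialPower b (x i) α (μ + (m - 1 - j)) := by
      rw [Finset.mul_sum]
      exact Finset.sum_congr rfl fun _ _ => by ring
    rw [h2, h3, show u * (x i - z) * ((1 + b * x i) ^ (j : ℕ) *
      ∑ μ ∈ Finset.Icc (l (j + 1)) (l j), branchWeight b z α (m - 1 - j) (l (j + 1)) (l j) μ *
          factorialPower b (x i) α (μ + (m - 1 - j))) = u * (1 + b * x i) ^ (j : ℕ) *
      ((x i - z) * ∑ μ ∈ Finset.Icc (l (j + 1)) (l j),
        branchWeight b z α (m - 1 - j) (l (j + 1)) (l j) μ *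
          factorialPower b (x i) α (μ + (m - 1 - j))) by ring, ← h1]
    simp only [hF, hk, bialternant, Matrix.of_apply, Fin.val_castSucc, Fin.val_succ]
    have e1 : m + 1 - 1 - (j : ℕ) = m - 1 - j + 1 := by omega
    have e2 : m + 1 - 1 - ((j : ℕ) + 1) = m - 1 - j := by omega
    rw [e1, e2, ← add_assoc, pow_succ]
    linear_combination (-(1 + b * x i) ^ (j : ℕ) *
      factorialPower b (x i) α (l j + (m - 1 - j) + 1)) * hu
  have hdet : F.det = B.det := by
    refine det_eq_of_col_sub_succ k ?_ ?_ <;> intros <;> simp [hB]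
  have hlast : B (Fin.last m) (Fin.last m) = (1 + b * z) ^ m * factorialPower b z α (l m) := by
    simp [hB, hF, bialternant, hz]
  have hsub : B.submatrix Fin.castSucc Fin.castSucc = Matrix.of fun i j : Fin m =>
      (u * (x i - z)) * (Matrix.of fun i j : Fin m => ∑ μ ∈ Finset.Icc (l (j + 1)) (l j),
        branchWeight b z α (m - 1 - j) (l (j + 1)) (l j) μ *
          ((1 + b * x i) ^ (j : ℕ) * factorialPower b (x i) α (μ + (m - 1 - j)))) i j := by
    ext i j
    simp [hBval]
  rw [hdet, det_eq_of_last_row B (fun j => by rw [hBval]; simp [hz]), hlast, hsub,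
    Matrix.det_mul_column, det_sum_col (fun j : Fin m => Finset.Icc (l (j + 1)) (l j))
      (fun j μ => branchWeight b z α (m - 1 - j) (l (j + 1)) (l j) μ)
      (fun j μ i => (1 + b * x i) ^ (j : ℕ) * factorialPower b (x i) α (μ + (m - 1 - j))),
    Finset.prod_mul_distrib, Finset.prod_const, Finset.card_univ, Fintype.card_fin,
    Fin.prod_univ_eq_prod_range (fun i => x i - z) m]
  -- The corner entry contributes `(1 + b z)^m`, which cancels the factors `u` taken out of the `m`
  -- rows.
  have hpow : (1 + b * z) ^ m * u ^ m = 1 := by rw [← mul_pow, mul_comm, hu, one_pow]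
  have hsum : ∀ μ : Fin m → ℕ, (Matrix.of fun i j : Fin m =>
      (1 + b * x i) ^ (j : ℕ) * factorialPower b (x i) α (μ j + (m - 1 - j))) =
      bialternant b m (extendZero μ) x α := by
    intro μ
    ext i j
    simp [bialternant]
  simp only [hsum]
  have hs : ∀ s : Finset (Fin m → ℕ), ∑ μ ∈ s,
      (∏ i : Fin m, branchWeight b z α (m - 1 - i) (l (i + 1)) (l i) (μ i)) *
            factorialPower b z α (l m) * (bialternant b m (extendZero μ) x α).det =
      factorialPower b z α (l m) * ∑ μ ∈ s,
      (∏ i : Fin m, branchWeight b z α (m - 1 - i) (l (i + 1)) (l i) (μ i)) *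
           (bialternant b m (extendZero μ) x α).det := by
    intro s
    rw [Finset.mul_sum]
    exact Finset.sum_congr rfl fun _ _ => by ring
  rw [hs]
  linear_combination (factorialPower b z α (l m) * (∏ i ∈ Finset.range m, (x i - z)) *
    ∑ μ ∈ Fintype.piFinset fun i : Fin m => Finset.Icc (l (i + 1)) (l i),
      (∏ i : Fin m, branchWeight b z α (m - 1 - i) (l (i + 1)) (l i) (μ i)) *
           (bialternant b m (extendZero μ) x α).det) * hpow

end Bialternant

/-! ## The branching rule for set-valued tableaux -/

section Tableaux

variable {n K : ℕ}

/-- Set-valued tableaux of shape `l` with entries less than `m`, as functions on a box of `n` rows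
and `K` columns which vanish outside the shape. -/
structure IsBoxedTableau (m : ℕ) (l : ℕ → ℕ) (T : Fin n × Fin K → Finset (Fin n)) : Prop where
  support : ∀ i c, (T (i, c)).Nonempty ↔ (c : ℕ) < l i
  bound : ∀ i c, ∀ r ∈ T (i, c), (r : ℕ) < m
  row : ∀ (i : Fin n) (c d : Fin K), (c : ℕ) + 1 = d → ∀ r ∈ T (i, c), ∀ s ∈ T (i, d), r ≤ s
  column : ∀ (i j : Fin n) (c : Fin K), (i : ℕ) + 1 = j → ∀ r ∈ T (i, c), ∀ s ∈ T (j, c), r < s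

/-- Strictness down the columns; consequently entries less than `m` occupy at most the first `m`
rows. -/
theorem IsBoxedTableau.le_entry {m : ℕ} {l : ℕ → ℕ} (hl : Antitone l)
    {T : Fin n × Fin K → Finset (Fin n)} (hT : IsBoxedTableau m l T) (i : Fin n) (c : Fin K)
    (r : Fin n) (hr : r ∈ T (i, c)) : (i : ℕ) ≤ r := by
  obtain ⟨i, hi⟩ := i
  induction i generalizing r with
  | zero => exact Nat.zero_le _
  | succ i ih =>
    have h1 : (c : ℕ) < l (i + 1) := (hT.support ⟨i + 1, hi⟩ c).1 ⟨r, hr⟩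
    obtain ⟨s, hs⟩ := (hT.support ⟨i, by omega⟩ c).2 (h1.trans_le (hl (Nat.le_succ i)))
    have h2 := ih s (by omega) hs
    have h3 : (s : ℕ) < r := hT.column ⟨i, by omega⟩ ⟨i + 1, hi⟩ c rfl s hs r hr
    simp only at h2 ⊢
    omega

/-- Removal of the entries which are not less than `m`. -/
def restrictEntries (m : ℕ) (T : Fin n × Fin K → Finset (Fin n)) :
    Fin n × Fin K → Finset (Fin n) :=
  fun u => (T u).filter fun r => (r : ℕ) < m

theorem mem_restrictEntries {m : ℕ} {T : Fin n × Fin K → Finset (Fin n)} {u : Fin n × Fin K}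
    {r : Fin n} : r ∈ restrictEntries m T u ↔ r ∈ T u ∧ (r : ℕ) < m := by
  simp [restrictEntries]

theorem exists_initial_segment {P : Fin K → Prop}
    (h : ∀ c d : Fin K, (c : ℕ) + 1 = d → P d → P c) : ∃ p ≤ K, ∀ c, P c ↔ (c : ℕ) < p := by
  classical
  by_cases hex : ∃ p, ∃ hp : p < K, ¬ P ⟨p, hp⟩
  · obtain ⟨hp, hP⟩ := Nat.find_spec hex
    refine ⟨Nat.find hex, hp.le, fun c => ⟨fun hc => ?_, fun hc => ?_⟩⟩
    · by_contra hlt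
      have hdown : ∀ e : ℕ, ∀ he : Nat.find hex + e < K, ¬ P ⟨Nat.find hex + e, he⟩ := by
        intro e
        induction e with
        | zero => intro _; exact hP
        | succ e ih => intro he hPe; exact ih (by omega) (h ⟨_, by omega⟩ ⟨_, he⟩ rfl hPe)
      refine hdown (c - Nat.find hex) (by omega) ?_
      convert hc using 1
      ext
      simp only
      omega
    · by_contra hn
      exact Nat.find_min hex hc ⟨c.2, hn⟩
  · push Not at hex
    exact ⟨K, le_rfl, fun c => ⟨fun _ => c.2, fun _ => hex c c.2⟩⟩

/-- The shapes interlace: a cell directly above a cell of `l` only has entries smaller than some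
entry `≤ m`, so it stays non-empty once `m` is removed. This is the bound `l (i + 1) ≤ μ i`. -/
theorem IsBoxedTableau.exists_shape_restrictEntries {m : ℕ} (hm : m < n) {l : ℕ → ℕ}
    (hl : Antitone l) (hK : l 0 ≤ K) {T : Fin n × Fin K → Finset (Fin n)}
    (hT : IsBoxedTableau (m + 1) l T) :
    ∃ μ : Fin m → ℕ, (∀ i : Fin m, l (i + 1) ≤ μ i ∧ μ i ≤ l i) ∧
      IsBoxedTableau m (extendZero μ) (restrictEntries m T) := by
  have hseg : ∀ i : Fin n, ∃ p ≤ K, ∀ c, (restrictEntries m T (i, c)).Nonempty ↔ (c : ℕ) < p := by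
    refine fun i => exists_initial_segment fun c d hcd ⟨s, hs⟩ => ?_
    rw [mem_restrictEntries] at hs
    have h1 := (hT.support i d).1 ⟨s, hs.1⟩
    obtain ⟨r, hr⟩ := (hT.support i c).2 (by omega)
    have h2 : (r : ℕ) ≤ s := hT.row i c d hcd r hr s hs.1
    exact ⟨r, mem_restrictEntries.2 ⟨hr, by omega⟩⟩
  choose p hpK hp using hseg
  refine ⟨fun i => p ⟨i, by omega⟩, fun i => ⟨?_, ?_⟩, ?_, ?_, ?_, ?_⟩
  · by_contra hlt
    push Not at hlt
    have h0 : l (i + 1) ≤ K := (hl (Nat.zero_le _)).trans hK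
    set c : Fin K := ⟨p ⟨i, by omega⟩, by omega⟩ with hc
    obtain ⟨s, hs⟩ := (hT.support ⟨i + 1, by omega⟩ c).2 hlt
    obtain ⟨r, hr⟩ := (hT.support ⟨i, by omega⟩ c).2 (hlt.trans_le (hl (Nat.le_succ (i : ℕ))))
    have h1 : (r : ℕ) < s := hT.column ⟨i, by omega⟩ ⟨i + 1, by omega⟩ c rfl r hr s hs
    have h2 := hT.bound _ _ s hs
    have h3 := (hp ⟨i, by omega⟩ c).1 ⟨r, mem_restrictEntries.2 ⟨hr, by omega⟩⟩
    exact lt_irrefl _ h3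
  · by_contra hlt
    push Not at hlt
    have h0 := hpK ⟨i, by omega⟩
    obtain ⟨r, hr⟩ := (hp ⟨i, by omega⟩ ⟨l i, by omega⟩).2 hlt
    have := (hT.support ⟨i, by omega⟩ ⟨l i, by omega⟩).1 ⟨r, (mem_restrictEntries.1 hr).1⟩
    exact lt_irrefl _ this
  · intro i c
    by_cases hi : (i : ℕ) < m
    · simpa [extendZero, hi] using hp i c
    · simp only [extendZero, hi, dif_neg, not_false_eq_true, not_lt_zero, iff_false]
      rintro ⟨r, hr⟩
      rw [mem_restrictEntries] at hr
      have := hT.le_entry hl i c r hr.1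
      omega
  · exact fun i c r hr => (mem_restrictEntries.1 hr).2
  · exact fun i c d hcd r hr s hs =>
      hT.row i c d hcd r (mem_restrictEntries.1 hr).1 s (mem_restrictEntries.1 hs).1
  · exact fun i j c hij r hr s hs =>
      hT.column i j c hij r (mem_restrictEntries.1 hr).1 s (mem_restrictEntries.1 hs).1

/-- The ways to fill a cell by adding the entry `m` to a tableau `S` of shape `μ`, such that a
tableau of shape `l` results. -/
def cellOptions (m : Fin n) (l μ : ℕ → ℕ) (S : Fin n × Fin K → Finset (Fin n))
    (u : Fin n × Fin K) : Finset (Finset (Fin n)) :=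
  if (u.2 : ℕ) < μ u.1 then
    if (u.2 : ℕ) + 1 = μ u.1 ∧ l (u.1 + 1) ≤ u.2 then {S u, insert m (S u)} else {S u}
  else if (u.2 : ℕ) < l u.1 then {insert m (S u)} else {S u}

theorem mem_cellOptions {m : Fin n} {l μ : ℕ → ℕ} {S : Fin n × Fin K → Finset (Fin n)}
    {u : Fin n × Fin K} (hS : m ∉ S u) (hμ : μ u.1 ≤ l u.1) {s : Finset (Fin n)} :
    s ∈ cellOptions m l μ S u ↔ s.erase m = S u ∧
      (m ∈ s → ((u.2 : ℕ) + 1 = μ u.1 ∧ l (u.1 + 1) ≤ u.2 ∨ μ u.1 ≤ u.2) ∧ (u.2 : ℕ) < l u.1) ∧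
      (μ u.1 ≤ u.2 → (u.2 : ℕ) < l u.1 → m ∈ s) := by
  have h1 : s = S u ↔ s.erase m = S u ∧ m ∉ s := by
    constructor
    · rintro rfl; exact ⟨Finset.erase_eq_of_notMem hS, hS⟩
    · rintro ⟨h, h'⟩; rwa [Finset.erase_eq_of_notMem h'] at h
  have h2 : s = insert m (S u) ↔ s.erase m = S u ∧ m ∈ s := by
    constructor
    · rintro rfl; exact ⟨Finset.erase_insert hS, Finset.mem_insert_self _ _⟩
    · rintro ⟨h, h'⟩; rw [← h, Finset.insert_erase h']
  unfold cellOptions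
  split_ifs with h3 h4 h5 <;>
    simp only [Finset.mem_insert, Finset.mem_singleton, h1, h2] <;>
    by_cases hms : m ∈ s <;> simp [hms] <;> intros <;> omega

/-- Whether `m` may be added is decided cell by cell: it is forced in the cells of `l` outside `μ`,
optional in the last cell of a row of `μ` with no cell of `l` below it, and forbidden elsewhere.
This independence makes the sum over extensions of `S` a product over cells. -/
theorem isBoxedTableau_succ_iff {m : Fin n} {l μ : ℕ → ℕ} (hl : Antitone l)
    (hlm : l (m + 1) = 0) (hK : l 0 ≤ K) (hμ : ∀ i, l (i + 1) ≤ μ i ∧ μ i ≤ l i)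
    {S : Fin n × Fin K → Finset (Fin n)} (hS : IsBoxedTableau m μ S)
    (T : Fin n × Fin K → Finset (Fin n)) :
    (IsBoxedTableau (m + 1) l T ∧ restrictEntries m T = S) ↔
      T ∈ Fintype.piFinset (cellOptions m l μ S) := by
  have hmS : ∀ u, m ∉ S u := fun u hu => lt_irrefl _ (hS.bound u.1 u.2 m hu)
  simp only [Fintype.mem_piFinset, mem_cellOptions (hmS _) (hμ _).2]
  constructor
  · rintro ⟨hT, rfl⟩ ⟨i, c⟩
    have hsub : ∀ i c r, r ∈ T (i, c) → r ≠ m → r ∈ restrictEntries m T (i, c) := by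
      intro i c r hr hrm
      have := hT.bound i c r hr
      exact mem_restrictEntries.2 ⟨hr, by have := Fin.val_ne_of_ne hrm; omega⟩
    refine ⟨?_, fun hm => ⟨?_, (hT.support i c).1 ⟨m, hm⟩⟩, fun h1 h2 => ?_⟩
    · ext r
      rw [Finset.mem_erase]
      refine ⟨fun h => hsub i c r h.2 h.1, fun h => ?_⟩
      rw [mem_restrictEntries] at h
      exact ⟨fun e => by subst e; omega, h.1⟩
    · by_contra hcon
      simp only [not_or, not_and, not_le] at hcon
      have h3 := (hμ i).2
      have h4 := hl (Nat.zero_le i)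
      rcases eq_or_ne ((c : ℕ) + 1) (μ i) with h5 | h5
      · have h6 := hcon.1 h5
        have h7 : (i : ℕ) + 1 < n := by
          by_contra h7
          have := hl (by omega : (m : ℕ) + 1 ≤ i + 1)
          omega
        obtain ⟨s, hs⟩ := (hT.support ⟨i + 1, h7⟩ c).2 h6
        have h8 : (m : ℕ) < s := hT.column i ⟨i + 1, h7⟩ c rfl m hm s hs
        have := hT.bound _ _ s hs
        omega
      -- The next cell of the row still lies in `μ`, so it has an entry less than `m`, against weak
      -- increase along the row.
      · obtain ⟨s, hs⟩ := (hS.support i ⟨c + 1, by omega⟩).2 (by simp only; omega)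
        have h6 : (m : ℕ) ≤ s :=
          hT.row i c ⟨c + 1, by omega⟩ rfl m hm s (mem_restrictEntries.1 hs).1
        have := (mem_restrictEntries.1 hs).2
        omega
    · obtain ⟨r, hr⟩ := (hT.support i c).2 h2
      by_cases hrm : r = m
      · exact hrm ▸ hr
      · have := (hS.support i c).1 ⟨r, hsub i c r hr hrm⟩
        simp only at h1
        omega
  · intro h
    have hE : ∀ u r, r ∈ T u ↔ (r = m ∧ m ∈ T u) ∨ r ∈ S u := by
      intro u r
      rw [← (h u).1, Finset.mem_erase]
      by_cases hr : r = m
      · subst hr; simp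
      · simp [hr]
    have hmT : ∀ (i : Fin n) (c : Fin K), m ∈ T (i, c) →
        ((c : ℕ) + 1 = μ i ∧ l (i + 1) ≤ c ∨ μ i ≤ c) ∧ (c : ℕ) < l i :=
      fun i c hm => (h (i, c)).2.1 hm
    refine ⟨⟨?_, ?_, ?_, ?_⟩, ?_⟩
    · intro i c
      constructor
      · rintro ⟨r, hr⟩
        rcases (hE _ _).1 hr with ⟨_, hr⟩ | hr
        · exact (hmT i c hr).2
        · exact ((hS.support i c).1 ⟨r, hr⟩).trans_le (hμ i).2
      · intro hc
        rcases lt_or_ge (c : ℕ) (μ i) with h1 | h1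
        · obtain ⟨r, hr⟩ := (hS.support i c).2 h1
          exact ⟨r, (hE _ _).2 (Or.inr hr)⟩
        · exact ⟨m, (h (i, c)).2.2 h1 hc⟩
    · intro i c r hr
      rcases (hE _ _).1 hr with ⟨rfl, _⟩ | hr
      · omega
      · exact (hS.bound i c r hr).trans (Nat.lt_succ_self _)
    · intro i c d hcd r hr s hs
      rcases (hE _ _).1 hr with ⟨rfl, hr⟩ | hr <;> rcases (hE _ _).1 hs with ⟨rfl, hs⟩ | hs
      · exact le_rfl
      · have h1 := (hS.support i d).1 ⟨s, hs⟩
        have h2 := hmT i c hr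
        omega
      · exact (Fin.lt_def.2 (hS.bound i c r hr)).le
      · exact hS.row i c d hcd r hr s hs
    · intro i j c hij r hr s hs
      have hj : (c : ℕ) < l (i + 1) := by
        rw [hij]
        rcases (hE _ _).1 hs with ⟨_, hs⟩ | hs
        · exact (hmT j c hs).2
        · exact ((hS.support j c).1 ⟨s, hs⟩).trans_le (hμ j).2
      rcases (hE _ _).1 hr with ⟨rfl, hr⟩ | hr
      · have h2 := hmT i c hr
        have h3 := (hμ i).1
        omega
      · rcases (hE _ _).1 hs with ⟨rfl, hs⟩ | hs
        · exact Fin.lt_def.2 (hS.bound i c r hr)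
        · exact hS.column i j c hij r hr s hs
    · ext u r
      rw [mem_restrictEntries, hE]
      constructor
      · rintro ⟨⟨rfl, _⟩ | h1, h2⟩
        · omega
        · exact h1
      · exact fun h1 => ⟨Or.inr h1, hS.bound u.1 u.2 r h1⟩

variable {A : Type*} [CommRing A]

/-- The weight of a cell with a set of entries. -/
def cellWeight (b : A) (x : ℕ → A) (a : ℤ → A) (u : Fin n × Fin K) (s : Finset (Fin n)) : A :=
  b ^ (s.card - 1) *
    ∏ r ∈ s, oplus b (x r) (a (((r : ℕ) : ℤ) + ((u.2 : ℕ) : ℤ) - ((u.1 : ℕ) : ℤ) + 1))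

open scoped Classical in
/-- The factorial Grothendieck polynomial in the first `m` variables, as a sum over boxed
tableaux. -/
def boxedG (n K : ℕ) (b : A) (m : ℕ) (l : ℕ → ℕ) (x : ℕ → A) (a : ℤ → A) : A :=
  ∑ T : Fin n × Fin K → Finset (Fin n) with IsBoxedTableau m l T, ∏ u, cellWeight b x a u (T u)

/-- The total weight, relative to the original one, of the ways to add the entry `m` to the cell
`(i, c)`. -/
def optionFactor (b : A) (x : ℕ → A) (a : ℤ → A) (m : ℕ) (l μ : ℕ → ℕ) (i c : ℕ) : A :=
  (if c + 1 = μ i ∧ l (i + 1) ≤ c then 1 + b * oplus b (x m) (a ((m : ℤ) + c - i + 1)) else 1) *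
    if μ i ≤ c ∧ c < l i then oplus b (x m) (a ((m : ℤ) + c - i + 1)) else 1

theorem sum_cellOptions (b : A) (x : ℕ → A) (a : ℤ → A) {m : Fin n} {l μ : ℕ → ℕ}
    {S : Fin n × Fin K → Finset (Fin n)} (hS : IsBoxedTableau m μ S)
    (u : Fin n × Fin K) :
    ∑ s ∈ cellOptions m l μ S u, cellWeight b x a u s =
      cellWeight b x a u (S u) * optionFactor b x a m l μ u.1 u.2 := by
  have hmS : m ∉ S u := fun hu => lt_irrefl _ (hS.bound u.1 u.2 m hu)
  have hsup : (S u).Nonempty ↔ (u.2 : ℕ) < μ u.1 := hS.support u.1 u.2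
  have hne : S u ≠ insert m (S u) := fun h => hmS (h ▸ Finset.mem_insert_self _ _)
  -- The exponent `card - 1` truncates to 0 on an empty cell, so `m` costs a factor `b` only where
  -- entries are already present.
  have hins : cellWeight b x a u (insert m (S u)) = (if (u.2 : ℕ) < μ u.1 then b else 1) *
      oplus b (x m) (a (((m : ℕ) : ℤ) + ((u.2 : ℕ) : ℤ) - ((u.1 : ℕ) : ℤ) + 1)) *
        cellWeight b x a u (S u) := by
    rw [cellWeight, cellWeight, Finset.card_insert_of_notMem hmS, Finset.prod_insert hmS]
    split_ifs with h
    · have := Finset.card_pos.2 (hsup.2 h)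
      obtain ⟨d, hd⟩ : ∃ d, (S u).card = d + 1 := ⟨(S u).card - 1, by omega⟩
      rw [hd, Nat.add_sub_cancel, Nat.add_sub_cancel, pow_succ]
      ring
    · rw [← hsup, Finset.not_nonempty_iff_eq_empty] at h
      simp [h]
  unfold cellOptions optionFactor
  split_ifs with h1 h2 h3 h3 <;> try omega
  all_goals simp only [Finset.sum_pair hne, Finset.sum_singleton, hins, h1, if_true, if_false]
  all_goals ring

theorem prod_optionFactor_row (b : A) (x : ℕ → A) (a : ℤ → A) {m i : ℕ} (hi : i < m)
    {l μ : ℕ → ℕ} (h1 : l (i + 1) ≤ μ i) (h2 : μ i ≤ l i) (hK : l i ≤ K) :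
    ∏ c ∈ Finset.range K, optionFactor b x a m l μ i c =
      branchWeight b (x m) (fun q => a (q + 1)) (m - 1 - i) (l (i + 1)) (l i) (μ i) := by
  unfold optionFactor branchWeight
  rw [Finset.prod_mul_distrib, mul_comm]
  congr 1
  · rw [← Finset.prod_filter]
    refine Finset.prod_congr ?_ fun c _ => ?_
    · ext c
      simp only [Finset.mem_filter, Finset.mem_range, Finset.mem_Ico]
      omega
    · congr 2
      push_cast
      omega
  · split_ifs with h3
    · exact Finset.prod_eq_one fun c _ => if_neg (by omega)
    -- The only cell with an optional `m` is the last one of the row. Truncated subtraction does no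
    -- harm, since `μ i > l (i + 1) ≥ 0` here.
    · rw [Finset.prod_eq_single (μ i - 1), if_pos (by omega)]
      · congr 4
        omega
      · exact fun c _ hc => if_neg (by omega)
      · intro h
        simp only [Finset.mem_range] at h
        omega

/-- Row `m` is empty before `m` is added, so all its cells are forced. -/
theorem prod_optionFactor_last (b : A) (x : ℕ → A) (a : ℤ → A) {m : ℕ}
    {l μ : ℕ → ℕ} (h1 : μ m = 0) (hK : l m ≤ K) :
    ∏ c ∈ Finset.range K, optionFactor b x a m l μ m c =
      factorialPower b (x m) (fun q => a (q + 1)) (l m) := by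
  unfold optionFactor factorialPower
  rw [Finset.prod_mul_distrib, Finset.prod_eq_one fun c _ => if_neg (by omega), one_mul,
    ← Finset.prod_filter]
  refine Finset.prod_congr ?_ fun c _ => ?_
  · ext c
    simp only [Finset.mem_filter, Finset.mem_range]
    omega
  · congr 2
    omega

theorem prod_optionFactor (b : A) (x : ℕ → A) (a : ℤ → A) {m : ℕ} (hm : m < n)
    {l μ : ℕ → ℕ} (hl : Antitone l) (hlm : l (m + 1) = 0) (hK : l 0 ≤ K)
    (hμ : ∀ i, l (i + 1) ≤ μ i ∧ μ i ≤ l i) (hμm : μ m = 0) :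
    ∏ u : Fin n × Fin K, optionFactor b x a m l μ u.1 u.2 =
      (∏ i : Fin m, branchWeight b (x m) (fun q => a (q + 1)) (m - 1 - i) (l (i + 1)) (l i)
        (μ i)) * factorialPower b (x m) (fun q => a (q + 1)) (l m) := by
  have hlK : ∀ i, l i ≤ K := fun i => (hl (Nat.zero_le i)).trans hK
  rw [Fintype.prod_prod_type]
  have hrow : ∀ i : Fin n, ∏ c : Fin K, optionFactor b x a m l μ i c =
      ∏ c ∈ Finset.range K, optionFactor b x a m l μ i c :=
    fun i => Fin.prod_univ_eq_prod_range (fun c => optionFactor b x a m l μ i c) K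
  simp only [hrow]
  rw [Fin.prod_univ_eq_prod_range (fun i => ∏ c ∈ Finset.range K, optionFactor b x a m l μ i c) n,
    Fin.prod_univ_eq_prod_range (fun i => branchWeight b (x m) (fun q => a (q + 1)) (m - 1 - i)
      (l (i + 1)) (l i) (μ i)) m, ← prod_optionFactor_last b x a hμm (hlK m),
    ← Finset.prod_subset (Finset.range_subset_range.2 (Nat.succ_le_of_lt hm)),
    Finset.prod_range_succ]
  · congr 1
    exact Finset.prod_congr rfl fun i hi =>
      prod_optionFactor_row b x a (Finset.mem_range.1 hi) (hμ i).1 (hμ i).2 (hlK i)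
  · intro i _ hi
    refine Finset.prod_eq_one fun c _ => ?_
    have h1 : l i ≤ l (m + 1) := hl (by simpa using hi)
    have h2 := (hμ i).2
    rw [optionFactor, if_neg (by omega), if_neg (by omega), one_mul]

/-- Tableaux are grouped by the shape `μ` left after removing `m`, then by the remaining tableau.
The coefficients are those of `det_bialternant_succ` without the factor `∏ (x_i - x_m)`. -/
theorem boxedG_succ (b : A) (x : ℕ → A) (a : ℤ → A) {m : ℕ} (hm : m < n)
    {l : ℕ → ℕ} (hl : Antitone l) (hlm : l (m + 1) = 0) (hK : l 0 ≤ K) :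
    boxedG n K b (m + 1) l x a =
      ∑ μ ∈ Fintype.piFinset fun i : Fin m => Finset.Icc (l (i + 1)) (l i),
        (∏ i : Fin m, branchWeight b (x m) (fun q => a (q + 1)) (m - 1 - i) (l (i + 1)) (l i)
          (μ i)) * factorialPower b (x m) (fun q => a (q + 1)) (l m) *
            boxedG n K b m (extendZero μ) x a := by
  classical
  have hint : ∀ μ : Fin m → ℕ, (∀ i : Fin m, l (i + 1) ≤ μ i ∧ μ i ≤ l i) →
      ∀ i, l (i + 1) ≤ extendZero μ i ∧ extendZero μ i ≤ l i := by
    intro μ hμ i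
    by_cases hi : i < m
    · simpa [extendZero, hi] using hμ ⟨i, hi⟩
    · rw [extendZero_of_le μ (by omega)]
      have : l (i + 1) ≤ l (m + 1) := hl (by omega)
      omega
  have hfib : ∀ μ ∈ Fintype.piFinset fun i : Fin m => Finset.Icc (l (i + 1)) (l i),
      ((∏ i : Fin m, branchWeight b (x m) (fun q => a (q + 1)) (m - 1 - i) (l (i + 1)) (l i)
          (μ i)) * factorialPower b (x m) (fun q => a (q + 1)) (l m) *
            boxedG n K b m (extendZero μ) x a) =
      ∑ T : Fin n × Fin K → Finset (Fin n) with IsBoxedTableau (m + 1) l T ∧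
        IsBoxedTableau m (extendZero μ) (restrictEntries m T), ∏ u, cellWeight b x a u (T u) := by
    intro μ hμ
    simp only [Fintype.mem_piFinset, Finset.mem_Icc] at hμ
    have hμ' := hint μ hμ
    have hp := prod_optionFactor (n := n) (K := K) b x a hm hl hlm hK hμ'
      (extendZero_of_le μ le_rfl)
    simp only [extendZero_val] at hp
    rw [← hp, ← Finset.sum_fiberwise_of_maps_to (g := restrictEntries m)
      (t := Finset.univ.filter (IsBoxedTableau m (extendZero μ))), boxedG, Finset.mul_sum]
    · refine Finset.sum_congr rfl fun S hS => ?_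
      have hS : IsBoxedTableau m (extendZero μ) S := (Finset.mem_filter.1 hS).2
      rw [mul_comm, ← Finset.prod_mul_distrib]
      have h1 := fun u => sum_cellOptions b x a (m := ⟨m, hm⟩) (l := l) hS u
      simp only at h1
      simp only [← h1]
      rw [Finset.prod_univ_sum]
      refine Finset.sum_congr ?_ fun _ _ => rfl
      ext T
      rw [← isBoxedTableau_succ_iff (m := ⟨m, hm⟩) hl hlm hK hμ' hS T]
      simp only [Finset.mem_filter, Finset.mem_univ, true_and]
      constructor
      · rintro ⟨h, rfl⟩; exact ⟨⟨h, hS⟩, rfl⟩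
      · rintro ⟨⟨h, _⟩, h'⟩; exact ⟨h, h'⟩
    · intro T hT
      exact Finset.mem_filter.2 ⟨Finset.mem_univ _, (Finset.mem_filter.1 hT).2.2⟩
  have hshape : ∀ T : Fin n × Fin K → Finset (Fin n), ∃ μ : Fin m → ℕ,
      IsBoxedTableau (m + 1) l T → (∀ i : Fin m, l (i + 1) ≤ μ i ∧ μ i ≤ l i) ∧
        IsBoxedTableau m (extendZero μ) (restrictEntries m T) := by
    intro T
    by_cases hT : IsBoxedTableau (m + 1) l T
    · obtain ⟨μ, h⟩ := hT.exists_shape_restrictEntries hm hl hK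
      exact ⟨μ, fun _ => h⟩
    -- An arbitrary shape for functions that are not tableaux; they do not enter the sum.
    · exact ⟨0, fun h => absurd h hT⟩
  choose sh hsh using hshape
  rw [Finset.sum_congr rfl hfib, boxedG, ← Finset.sum_fiberwise_of_maps_to (g := sh)
    (t := Fintype.piFinset fun i : Fin m => Finset.Icc (l (i + 1)) (l i))]
  · refine Finset.sum_congr rfl fun μ hμ => Finset.sum_congr ?_ fun _ _ => rfl
    ext T
    simp only [Finset.mem_filter, Finset.mem_univ, true_and]
    constructor
    · rintro ⟨h, rfl⟩; exact ⟨h, (hsh T h).2⟩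
    · rintro ⟨h, h'⟩
      refine ⟨h, funext fun i => ?_⟩
      simp only [Fintype.mem_piFinset, Finset.mem_Icc] at hμ
      obtain ⟨h1, h2⟩ := hsh T h
      -- The non-empty cells determine the row lengths, as no length exceeds `K`.
      have h3 : ∀ c : Fin K, (c : ℕ) < sh T i ↔ (c : ℕ) < μ i := by
        intro c
        have e1 := h2.support ⟨i, by omega⟩ c
        have e2 := h'.support ⟨i, by omega⟩ c
        simp only [extendZero_val] at e1 e2
        rw [← e1, e2]
      have h4 := (hl (Nat.zero_le i)).trans hK
      have h5 := (h1 i).2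
      have h6 := (hμ i).2
      rcases lt_trichotomy (sh T i) (μ i) with h7 | h7 | h7
      · have := (h3 ⟨sh T i, by omega⟩).2 h7; simp at this
      · exact h7
      · have := (h3 ⟨μ i, by omega⟩).1 h7; simp at this
  · intro T hT
    simp only [Fintype.mem_piFinset, Finset.mem_Icc]
    exact (hsh T (Finset.mem_filter.1 hT).2).1

theorem boxedG_zero (b : A) (x : ℕ → A) (a : ℤ → A) {l : ℕ → ℕ} (hl : ∀ i, l i = 0) :
    boxedG n K b 0 l x a = 1 := by
  classical
  rw [boxedG, Finset.sum_eq_single fun _ => ∅]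
  · simp [cellWeight]
  · intro T hT hne
    refine absurd (funext fun u => ?_) hne
    rw [← Finset.not_nonempty_iff_eq_empty]
    rw [(Finset.mem_filter.1 hT).2.support u.1 u.2, hl]
    simp
  · intro h
    refine absurd (Finset.mem_filter.2 ⟨Finset.mem_univ _, ?_⟩) h
    constructor <;> simp [hl]

/-- Both sides satisfy the same recursion, and the extra factor `∏ (x_i - x_m)` on the determinant
side extends the Vandermonde product by one variable. -/
theorem det_bialternant_eq_boxedG (b : A) (x : ℕ → A) (a : ℤ → A) {m : ℕ} (hm : m ≤ n)
    (hu : ∀ i < m, IsUnit (1 + b * x i)) {l : ℕ → ℕ} (hl : Antitone l) (hlm : l m = 0)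
    (hK : l 0 ≤ K) :
    (bialternant b m l x fun q => a (q + 1)).det =
      vandermondeProd m x * boxedG n K b m l x a := by
  induction m generalizing l with
  | zero =>
    rw [boxedG_zero b x a fun i => by have := hl (Nat.zero_le i); omega]
    simp [vandermondeProd]
  | succ m ih =>
    rw [det_bialternant_succ b m hl _ _ (hu m (Nat.lt_succ_self m)),
      boxedG_succ b x a hm hl hlm hK, vandermondeProd, Finset.prod_range_succ, Finset.mul_sum,
      Finset.mul_sum]
    refine Finset.sum_congr rfl fun μ hμ => ?_
    simp only [Fintype.mem_piFinset, Finset.mem_Icc] at hμ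
    rw [ih (by omega) (fun i hi => hu i (by omega)) (l := extendZero μ), vandermondeProd]
    · ring
    · refine antitone_nat_of_succ_le fun i => ?_
      by_cases hi : i + 1 < m
      · have h1 := (hμ ⟨i, by omega⟩).1
        have h2 := (hμ ⟨i + 1, hi⟩).2
        simp only [extendZero, hi, (by omega : i < m), dif_pos]
        exact h2.trans h1
      · rw [extendZero_of_le μ (by omega)]
        exact Nat.zero_le _
    · exact extendZero_of_le μ le_rfl
    · by_cases h0 : 0 < m
      · simpa [extendZero, h0] using (hμ ⟨0, h0⟩).2.trans hK
      · rw [extendZero_of_le μ (by omega)]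
        exact Nat.zero_le _

end Tableaux

/-! ## The bialternant formula and its consequences -/

section BialternantFormula

variable {A : Type*} [CommRing A]

theorem prod_dite_lt {M : Type*} [CommMonoid M] {s K : ℕ} (h : s ≤ K) (g : Fin s → M) :
    ∏ c : Fin K, (if hc : (c : ℕ) < s then g ⟨c, hc⟩ else 1) = ∏ c, g c := by
  rw [Fin.prod_univ_eq_prod_range (fun c => if hc : c < s then g ⟨c, hc⟩ else 1) K,
    ← Finset.prod_subset (Finset.range_subset_range.2 h), Finset.prod_range]
  · simp
  · intro c _ hc
    rw [Finset.mem_range] at hc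
    rw [dif_neg hc]

theorem extendZero_antitone {n : ℕ} {shape : Fin n → ℕ} (h : Antitone shape) :
    Antitone (extendZero shape) := by
  intro i j hij
  by_cases hj : j < n
  · simp only [extendZero, hj, lt_of_le_of_lt hij hj, dif_pos]
    exact h (Fin.mk_le_mk.2 hij)
  · rw [extendZero_of_le _ (not_lt.1 hj)]
    exact Nat.zero_le _

/-- As no cell is empty, no subtraction truncates and the exponent splits over the cells. -/
theorem pow_card_sub {n : ℕ} {b : A} {shape : Fin n → ℕ}
    {T : (i : Fin n) → Fin (shape i) → Finset (Fin n)} (h : ∀ i c, (T i c).Nonempty) :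
    b ^ ((∑ i, ∑ c, (T i c).card) - ∑ i, shape i) = ∏ i, ∏ c, b ^ ((T i c).card - 1) := by
  simp only [Finset.prod_pow_eq_pow_sum]
  congr 1
  have : ∑ i, ∑ c, (T i c).card = ∑ i, ∑ c, ((T i c).card - 1) + ∑ i, shape i := by
    rw [← Finset.sum_add_distrib]
    refine Finset.sum_congr rfl fun i _ => ?_
    have h1 : ∀ c, (T i c).card = ((T i c).card - 1) + 1 := fun c => by
      have := Finset.card_pos.2 (h i c)
      omega
    rw [Finset.sum_congr rfl fun c _ => h1 c, Finset.sum_add_distrib]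
    simp
  omega

/-- A fixed box gives tableaux of all shapes a common type, which the induction over shapes needs;
cells outside the shape are empty and have weight 1. -/
theorem factorialG_eq_boxedG {n K : ℕ} (b : A) {shape : Fin n → ℕ} (hK : ∀ i, shape i ≤ K)
    (x : Fin n → A) (a : ℤ → A) :
    factorialG b shape x a = boxedG n K b n (extendZero shape) (extendZero x) a := by
  classical
  set toBox : ((i : Fin n) → Fin (shape i) → Finset (Fin n)) → Fin n × Fin K → Finset (Fin n) :=
    fun T u => if h : (u.2 : ℕ) < shape u.1 then T u.1 ⟨u.2, h⟩ else ∅ with htoBox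
  have hmem : ∀ T i (c : Fin K) r, r ∈ toBox T (i, c) ↔
      ∃ h : (c : ℕ) < shape i, r ∈ T i ⟨c, h⟩ := by
    intro T i c r
    simp only [htoBox]
    split_ifs with h <;> simp [h]
  rw [factorialG, boxedG]
  refine Finset.sum_bij' (fun T _ => toBox T)
    (fun T _ i c => T (i, ⟨c, c.2.trans_le (hK i)⟩)) ?_ ?_ ?_ ?_ ?_
  · intro T hT
    have hT := (Finset.mem_filter.1 hT).2
    refine Finset.mem_filter.2 ⟨Finset.mem_univ _, ?_, ?_, ?_, ?_⟩
    · intro i c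
      rw [extendZero_val]
      constructor
      · rintro ⟨r, hr⟩
        exact ((hmem _ _ _ _).1 hr).1
      · intro h
        obtain ⟨r, hr⟩ := hT.nonempty i ⟨c, h⟩
        exact ⟨r, (hmem _ _ _ _).2 ⟨h, hr⟩⟩
    · exact fun i c r _ => r.2
    · intro i c d hcd r hr s hs
      obtain ⟨h1, hr⟩ := (hmem _ _ _ _).1 hr
      obtain ⟨h2, hs⟩ := (hmem _ _ _ _).1 hs
      exact hT.row i _ _ hcd r hr s hs
    · intro i j c hij r hr s hs
      obtain ⟨h1, hr⟩ := (hmem _ _ _ _).1 hr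
      obtain ⟨h2, hs⟩ := (hmem _ _ _ _).1 hs
      exact hT.column i j _ _ hij rfl r hr s hs
  · intro T hT
    have hT := (Finset.mem_filter.1 hT).2
    refine Finset.mem_filter.2 ⟨Finset.mem_univ _, ?_, ?_, ?_⟩
    · intro i c
      rw [hT.support, extendZero_val]
      exact c.2
    · exact fun i c d hcd r hr s hs => hT.row i _ _ hcd r hr s hs
    · intro i j c d hij hcd r hr s hs
      refine hT.column i j _ hij r hr s ?_
      convert hs using 3
      exact Fin.ext hcd
  · intro T _
    funext i c
    simp [htoBox]
  · intro T hT
    have hT := (Finset.mem_filter.1 hT).2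
    funext ⟨i, c⟩
    ext r
    refine (hmem (fun i c => T (i, ⟨c, c.2.trans_le (hK i)⟩)) i c r).trans ?_
    constructor
    · rintro ⟨h, hr⟩; exact hr
    · intro hr
      refine ⟨?_, hr⟩
      have := (hT.support i c).1 ⟨r, hr⟩
      rwa [extendZero_val] at this
  · intro T hT
    have hT := (Finset.mem_filter.1 hT).2
    rw [pow_card_sub hT.nonempty, ← Finset.prod_mul_distrib, Fintype.prod_prod_type]
    refine Finset.prod_congr rfl fun i _ => ?_
    rw [← Finset.prod_mul_distrib, ← prod_dite_lt (hK i)]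
    refine Finset.prod_congr rfl fun c _ => ?_
    by_cases h : (c : ℕ) < shape i <;> simp [htoBox, h, cellWeight]

/-- The matrix `((1 + b x_i)^j [x_i|α]^{e_j})`. -/
def powerMatrix {n : ℕ} (b : A) (e : Fin n → ℕ) (x : Fin n → A) (α : ℕ → A) :
    Matrix (Fin n) (Fin n) A :=
  Matrix.of fun i j => (1 + b * x i) ^ (j : ℕ) * factorialPower b (x i) α (e j)

/-- The exponents `l_j + n - 1 - j` in the bialternant of a partition. -/
def exponents {n : ℕ} (l : Fin n → ℕ) (j : Fin n) : ℕ := l j + (n - 1 - j)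

theorem exponents_strictAnti {n : ℕ} {l : Fin n → ℕ} (hl : Antitone l) :
    StrictAnti (exponents l) := by
  intro i j hij
  have h1 := hl hij.le
  have h2 : (i : ℕ) < j := hij
  simp only [exponents]
  omega

/-- The bialternant formula. Symmetry in `x` and the effect of exchanging parameters are both read
off from the determinant. -/
theorem det_powerMatrix {n : ℕ} (b : A) {shape : Fin n → ℕ} (hs : Antitone shape)
    {x : Fin n → A} (hx : ∀ i, IsUnit (1 + b * x i)) (a : ℤ → A) :
    (powerMatrix b (exponents shape) x fun q => a (q + 1)).det =
      vandermondeProd n (extendZero x) * factorialG b shape x a := by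
  have hK : ∀ i, shape i ≤ extendZero shape 0 := fun i => by
    rw [← extendZero_val shape i]
    exact extendZero_antitone hs (Nat.zero_le _)
  rw [factorialG_eq_boxedG b hK, ← det_bialternant_eq_boxedG b _ a le_rfl _
    (extendZero_antitone hs) (extendZero_of_le _ le_rfl) le_rfl]
  · congr 1
    ext i j
    simp [powerMatrix, bialternant, exponents]
  · intro i hi
    simpa [extendZero, hi] using hx ⟨i, hi⟩

theorem factorialG_zero {n : ℕ} (b : A) (x : Fin n → A) (a : ℤ → A) :
    factorialG b (fun _ : Fin n => 0) x a = 1 := by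
  rw [factorialG_eq_boxedG (K := 0) b (fun _ => le_rfl)]
  classical
  rw [boxedG, Finset.sum_eq_single fun _ => ∅]
  · simp
  · exact fun T _ hne => absurd (funext fun u => u.2.elim0) hne
  · refine fun h => absurd (Finset.mem_filter.2 ⟨Finset.mem_univ _, ?_⟩) h
    exact ⟨fun _ c => c.elim0, fun _ c => c.elim0, fun _ c => c.elim0, fun _ _ c => c.elim0⟩

theorem det_powerMatrix_comp_perm {n : ℕ} (b : A) (e : Fin n → ℕ) (x : Fin n → A) (α : ℕ → A)
    (σ : Equiv.Perm (Fin n)) :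
    (powerMatrix b e (x ∘ σ) α).det = Equiv.Perm.sign σ * (powerMatrix b e x α).det := by
  rw [← Matrix.det_permute]
  rfl

theorem isUnit_vandermondeProd {n : ℕ} {x : Fin n → A}
    (h : ∀ i j, i < j → IsUnit (x i - x j)) : IsUnit (vandermondeProd n (extendZero x)) := by
  unfold vandermondeProd
  refine IsUnit.prod_iff.2 fun j hj => IsUnit.prod_iff.2 fun i hi => ?_
  rw [Finset.mem_range] at hi hj
  simpa [extendZero, hj, hi.trans hj] using h ⟨i, hi.trans hj⟩ ⟨j, hj⟩ hi

theorem factorialG_comp_perm {n : ℕ} (b : A) {shape : Fin n → ℕ} (hs : Antitone shape)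
    {x : Fin n → A} (hx : ∀ i, IsUnit (1 + b * x i)) (hv : ∀ i j, i < j → IsUnit (x i - x j))
    (a : ℤ → A) (σ : Equiv.Perm (Fin n)) :
    factorialG b shape (x ∘ σ) a = factorialG b shape x a := by
  have hv := isUnit_vandermondeProd hv
  have h1 := det_powerMatrix b hs hx a
  have h2 := det_powerMatrix b hs (x := x ∘ σ) (fun i => hx (σ i)) a
  -- The empty shape has `G = 1`, so its determinant is the Vandermonde product; this gives the sign
  -- of the permuted Vandermonde product.
  have h3 := det_powerMatrix b (antitone_const (c := 0)) hx a
  have h4 := det_powerMatrix b (antitone_const (c := 0)) (x := x ∘ σ) (fun i => hx (σ i)) a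
  rw [factorialG_zero, mul_one] at h3 h4
  rw [det_powerMatrix_comp_perm] at h2 h4
  rw [← h4, h3, h1, mul_assoc] at h2
  have hsign : IsUnit (((Equiv.Perm.sign σ : ℤ) : A)) :=
    (Units.isUnit (Equiv.Perm.sign σ)).map (Int.castRingHom A)
  exact (hv.mul_left_cancel (hsign.mul_left_cancel h2)).symm

/-- The first `p` parameters contain both or neither of the two exchanged ones unless `p = j + 1`.
-/
theorem factorialPower_comp_swap (b x : A) (α : ℕ → A) {j p : ℕ} (h : p ≠ j + 1) :
    factorialPower b x (α ∘ Equiv.swap j (j + 1)) p = factorialPower b x α p := by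
  rcases Nat.lt_or_ge p (j + 1) with h1 | h1
  · refine Finset.prod_congr rfl fun q hq => ?_
    rw [Finset.mem_range] at hq
    rw [Function.comp_apply, Equiv.swap_apply_of_ne_of_ne (by omega) (by omega)]
  · refine Equiv.Perm.prod_comp (Equiv.swap j (j + 1)) (Finset.range p)
      (fun q => oplus b x (α q)) fun q hq => ?_
    rw [Finset.coe_range, Set.mem_Iio]
    by_contra hlt
    exact hq (Equiv.swap_apply_of_ne_of_ne (by omega) (by omega))

/-- Only the last factor changes, by `(α_{j+1} - α_j)(1 + b x)`. The factor `1 + b x` raises the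
power in the bialternant to that of the next column. -/
theorem factorialPower_comp_swap_self (b x : A) (α : ℕ → A) (j : ℕ) :
    factorialPower b x (α ∘ Equiv.swap j (j + 1)) (j + 1) =
      factorialPower b x α (j + 1) + (α (j + 1) - α j) * ((1 + b * x) * factorialPower b x α j) := by
  rw [factorialPower_succ, factorialPower_succ, factorialPower_comp_swap b x α (by omega),
    Function.comp_apply, Equiv.swap_apply_left]
  simp only [oplus]
  ring

theorem powerMatrix_comp_swap {n : ℕ} (b : A) {e : Fin n → ℕ} (x : Fin n → A) (α : ℕ → A) {j : ℕ}
    (h : ∀ l, e l ≠ j + 1) :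
    powerMatrix b e x (α ∘ Equiv.swap j (j + 1)) = powerMatrix b e x α := by
  ext i l
  simp [powerMatrix, factorialPower_comp_swap b (x i) α (h l)]

theorem powerMatrix_comp_swap_self {n : ℕ} (b : A) {e : Fin n → ℕ} (he : Function.Injective e)
    (x : Fin n → A) (α : ℕ → A) {j : ℕ} {l : Fin n} (h : e l = j + 1) :
    powerMatrix b e x (α ∘ Equiv.swap j (j + 1)) =
      (powerMatrix b e x α).updateCol l ((fun i => powerMatrix b e x α i l) +
        (α (j + 1) - α j) • fun i => (1 + b * x i) ^ ((l : ℕ) + 1) *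
          factorialPower b (x i) α j) := by
  ext i l'
  by_cases hl : l' = l
  · subst hl
    simp only [powerMatrix, Matrix.of_apply, h, factorialPower_comp_swap_self,
      Matrix.updateCol_self, Pi.add_apply, Pi.smul_apply, smul_eq_mul]
    ring
  · rw [Matrix.updateCol_ne hl]
    have : e l' ≠ j + 1 := fun h' => hl (he (h'.trans h.symm))
    simp [powerMatrix, factorialPower_comp_swap b (x i) α this]

/-- The exponents decrease strictly, so the columns of `j + 1` and `j` are adjacent. The change in
the first is then a multiple of the second, power of `1 + b x_i` included. -/
theorem det_powerMatrix_comp_swap_of_mem {n : ℕ} (b : A) {e : Fin n → ℕ} (he : StrictAnti e)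
    (x : Fin n → A) (α : ℕ → A) {j : ℕ} {l l' : Fin n} (h : e l = j + 1) (h' : e l' = j) :
    (powerMatrix b e x (α ∘ Equiv.swap j (j + 1))).det = (powerMatrix b e x α).det := by
  have hlt : l < l' := he.lt_iff_gt.1 (by omega)
  have hl : (l' : ℕ) = l + 1 := by
    by_contra hne
    have h0 : (l : ℕ) < l' := hlt
    have h1 := he (show l < ⟨l + 1, by omega⟩ from Fin.lt_def.2 (by simp))
    have h2 := he (show (⟨l + 1, by omega⟩ : Fin n) < l' from Fin.lt_def.2 (by simp; omega))
    omega
  rw [powerMatrix_comp_swap_self b he.injective x α h]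
  have : (fun i => (1 + b * x i) ^ ((l : ℕ) + 1) * factorialPower b (x i) α j) =
      fun i => powerMatrix b e x α i l' := by
    funext i
    simp [powerMatrix, h', hl]
  rw [this]
  exact Matrix.det_updateCol_add_smul_self _ hlt.ne _

/-- From `(1 + b α_j)(1 + b x) = 1 + b (x ⊕ α_j)`, the changed part of column `l` is, after
multiplication by `1 + b α_j`, the sum of `b` times the old column and the column with exponent `j`.
-/
theorem det_powerMatrix_comp_swap_of_notMem {n : ℕ} (b : A) {e : Fin n → ℕ} (he : StrictAnti e)
    (x : Fin n → A) (α : ℕ → A) {j : ℕ} {l : Fin n} (h : e l = j + 1) :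
    (1 + b * α j) * ((powerMatrix b e x (α ∘ Equiv.swap j (j + 1))).det -
        (powerMatrix b e x α).det) =
      (α (j + 1) - α j) * (b * (powerMatrix b e x α).det +
        (powerMatrix b (Function.update e l j) x α).det) := by
  set w : Fin n → A := fun i => (1 + b * x i) ^ ((l : ℕ) + 1) * factorialPower b (x i) α j with hw
  set F := powerMatrix b e x α with hF
  set v : Fin n → A := fun i => (1 + b * x i) ^ (l : ℕ) * factorialPower b (x i) α j with hv
  have h1 : powerMatrix b (Function.update e l j) x α = F.updateCol l v := by
    ext i l'
    by_cases hl : l' = l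
    · subst hl
      simp [powerMatrix, hv]
    · simp [powerMatrix, hl, hF]
  have h2 : (1 + b * α j) • w = b • (fun i => F i l) + v := by
    funext i
    simp only [hw, hv, hF, powerMatrix, Pi.smul_apply, Pi.add_apply, smul_eq_mul, Matrix.of_apply,
      h, factorialPower_succ, oplus]
    ring
  have h3 : F.updateCol l (fun i => F i l) = F := Matrix.updateCol_eq_self F l
  have h4 := congrArg (fun c => (F.updateCol l c).det) h2
  simp only [Matrix.det_updateCol_smul, Matrix.det_updateCol_add, h3] at h4
  rw [powerMatrix_comp_swap_self b he.injective x α h, h1, ← hF, ← h4, Matrix.det_updateCol_add,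
    Matrix.det_updateCol_smul, h3]
  ring

end BialternantFormula

/-! ## One-letters of boxed partitions -/

namespace BoxedPartition

variable {n k : ℕ}

theorem mem_ones {p : BoxedPartition n k} {u : Fin (n + k)} :
    u ∈ p.ones ↔ u ∈ Set.range p.position :=
  Set.powersetCard.mem_ofFinEmbEquiv_iff_mem_range p.position u

theorem ones_smul (w : Equiv.Perm (Fin (n + k))) (p : BoxedPartition n k) :
    (w • p).ones = p.ones.image w := by
  change (wordEquiv n k ((wordEquiv n k).symm (w • wordEquiv n k p))).val = _
  rw [Equiv.apply_symm_apply, Set.powersetCard.coe_smul]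
  rfl

theorem range_position_smul (w : Equiv.Perm (Fin (n + k))) (p : BoxedPartition n k) :
    Set.range (w • p).position = Set.range (w ∘ p.position) := by
  ext u
  rw [← mem_ones, ones_smul, Finset.mem_image, Set.range_comp]
  simp only [mem_ones, Set.mem_image]

theorem exponents_part (p : BoxedPartition n k) (l : Fin n) :
    exponents p.part l = p.position l.rev := by
  rw [position_val, Fin.rev_rev, exponents, Fin.val_rev]
  congr 1
  omega

theorem mem_ones_iff_exponents {p : BoxedPartition n k} {u : Fin (n + k)} :
    u ∈ p.ones ↔ ∃ l, exponents p.part l = u := by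
  rw [mem_ones]
  constructor
  · rintro ⟨i, rfl⟩
    exact ⟨i.rev, by rw [exponents_part, Fin.rev_rev]⟩
  · rintro ⟨l, hl⟩
    exact ⟨l.rev, Fin.ext (by rw [← hl, exponents_part])⟩

theorem exponents_lt (p : BoxedPartition n k) (l : Fin n) : exponents p.part l < n + k := by
  rw [exponents_part]
  exact Fin.is_lt _

theorem range_exponents (p : BoxedPartition n k) :
    Set.range (exponents p.part) = Fin.val '' (p.ones : Set (Fin (n + k))) := by
  ext a
  simp only [Set.mem_range, Set.mem_image, Finset.mem_coe, mem_ones_iff_exponents]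
  constructor
  · rintro ⟨l, rfl⟩
    exact ⟨⟨_, p.exponents_lt l⟩, ⟨l, rfl⟩, rfl⟩
  · rintro ⟨_, ⟨l, hl⟩, rfl⟩
    exact ⟨l, hl⟩

theorem strictAnti_eq_of_range_eq {e f : Fin n → ℕ} (he : StrictAnti e) (hf : StrictAnti f)
    (h : Set.range e = Set.range f) : e = f := by
  have he' : StrictMono (e ∘ Fin.rev) := fun i j hij => he (Fin.rev_lt_rev.2 hij)
  have hf' : StrictMono (f ∘ Fin.rev) := fun i j hij => hf (Fin.rev_lt_rev.2 hij)
  have h1 : e ∘ Fin.rev = f ∘ Fin.rev := by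
    refine (StrictMono.range_inj he' hf').1 ?_
    rw [Fin.rev_surjective.range_comp, Fin.rev_surjective.range_comp, h]
  funext i
  simpa using congrFun h1 i.rev

/-- As `j` is not an exponent, replacing `j + 1` by `j` preserves strict decrease, and a strictly
decreasing sequence is determined by its range. -/
theorem exponents_simpleSwap_smul {j : ℕ} (hj : j + 1 < n + k) {p : BoxedPartition n k}
    (h : (⟨j, by omega⟩ : Fin (n + k)) ∉ p.ones) {l : Fin n}
    (hl : exponents p.part l = j + 1) :
    exponents (simpleSwap j hj • p).part = Function.update (exponents p.part) l j := by
  have he := exponents_strictAnti p.anti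
  have hne : ∀ i, exponents p.part i ≠ j := fun i hi => h (mem_ones_iff_exponents.2 ⟨i, hi⟩)
  refine strictAnti_eq_of_range_eq (exponents_strictAnti (BoxedPartition.anti _)) ?_ ?_
  · intro i i' hii'
    have h1 := he hii'
    have h2 := hne i
    have h3 := hne i'
    rcases eq_or_ne i l with rfl | hi
    · rw [Function.update_self, Function.update_of_ne hii'.ne']
      omega
    · rcases eq_or_ne i' l with rfl | hi'
      · rw [Function.update_self, Function.update_of_ne hi]
        omega
      · rwa [Function.update_of_ne hi, Function.update_of_ne hi']
  · have hswap : ∀ i, ((simpleSwap j hj ⟨exponents p.part i, p.exponents_lt i⟩ : Fin (n + k)) : ℕ) =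
        Function.update (exponents p.part) l j i := by
      intro i
      rcases eq_or_ne i l with rfl | hi
      · rw [Function.update_self]
        simp only [hl, simpleSwap, Equiv.swap_apply_right]
      · rw [Function.update_of_ne hi, simpleSwap, Equiv.swap_apply_of_ne_of_ne]
        · exact fun h' => hne i (congrArg Fin.val h')
        · exact fun h' => hi (he.injective ((congrArg Fin.val h').trans hl.symm))
    rw [range_exponents, ones_smul]
    ext a
    simp only [Set.mem_image, Finset.mem_coe, Finset.mem_image, Set.mem_range, ← hswap]
    constructor
    · rintro ⟨_, ⟨u, hu, rfl⟩, rfl⟩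
      obtain ⟨i, hi⟩ := mem_ones_iff_exponents.1 hu
      exact ⟨i, by congr 2; exact Fin.ext hi⟩
    · rintro ⟨i, rfl⟩
      exact ⟨_, ⟨_, mem_ones_iff_exponents.2 ⟨i, rfl⟩, rfl⟩, rfl⟩

/-- Since `w` need not preserve the order of the one-letters, `σ` sorts their images. -/
theorem exists_perm_position_smul (w : Equiv.Perm (Fin (n + k))) (p : BoxedPartition n k) :
    ∃ σ : Equiv.Perm (Fin n), ∀ i, w (p.position (σ i)) = (w • p).position i := by
  have h : ∀ i, ∃ i', w (p.position i') = (w • p).position i := fun i => by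
    have h1 : (w • p).position i ∈ Set.range (w ∘ p.position) := by
      rw [← range_position_smul]
      exact ⟨i, rfl⟩
    exact h1
  choose σ hσ using h
  have hinj : Function.Injective σ := fun i i' hii' =>
    (w • p).position.injective (by rw [← hσ, ← hσ, hii'])
  exact ⟨Equiv.ofBijective σ (Finite.injective_iff_bijective.1 hinj), hσ⟩

end BoxedPartition

/-! ## Bethe roots -/

section PowerSeriesFixedPoint

variable {R : Type*} [CommRing R] {ι : Type*}

/-- Banach's fixed point argument for the `q`-adic topology: each application of `Φ` gains one power
of `q`, so iteration from the constants converges coefficientwise. -/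
theorem existsUnique_fixedPoint (c : ι → R) (Φ : (ι → PowerSeries R) → ι → PowerSeries R)
    (hc : ∀ y, (∀ i, PowerSeries.constantCoeff (y i) = c i) →
      ∀ i, PowerSeries.constantCoeff (Φ y i) = c i)
    (hΦ : ∀ (m : ℕ) (y z : ι → PowerSeries R), (∀ i, PowerSeries.constantCoeff (y i) = c i) →
      (∀ i, PowerSeries.constantCoeff (z i) = c i) →
      (∀ i, (PowerSeries.X : PowerSeries R) ^ m ∣ y i - z i) →
      ∀ i, (PowerSeries.X : PowerSeries R) ^ (m + 1) ∣ Φ y i - Φ z i) :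
    ∃ y : ι → PowerSeries R, ∀ z : ι → PowerSeries R,
      ((∀ i, PowerSeries.constantCoeff (z i) = c i) ∧ Φ z = z) ↔ z = y := by
  have hunique : ∀ y z : ι → PowerSeries R,
      (∀ m i, (PowerSeries.X : PowerSeries R) ^ m ∣ y i - z i) → y = z := by
    intro y z h
    funext i
    ext m
    have := PowerSeries.X_pow_dvd_iff.1 (h (m + 1) i) m (Nat.lt_succ_self m)
    rwa [map_sub, sub_eq_zero] at this
  set Y : ℕ → ι → PowerSeries R := fun m => Φ^[m] fun i => PowerSeries.C (c i) with hY
  have hYs : ∀ m, Y (m + 1) = Φ (Y m) := fun m => Function.iterate_succ_apply' Φ m _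
  have hYc : ∀ m i, PowerSeries.constantCoeff (Y m i) = c i := by
    intro m
    induction m with
    | zero => intro i; simp [hY]
    | succ m ih => rw [hYs]; exact hc _ ih
  have hstep : ∀ m i, (PowerSeries.X : PowerSeries R) ^ (m + 1) ∣ Y (m + 1) i - Y m i := by
    intro m
    induction m with
    | zero =>
      intro i
      rw [zero_add, pow_one, PowerSeries.X_dvd_iff, map_sub, hYc, hYc, sub_self]
    | succ m ih =>
      rw [hYs (m + 1), hYs m]
      refine hΦ _ _ _ (fun i => ?_) (hYc m) (fun i => ?_)
      · rw [← hYs]; exact hYc _ i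
      · rw [← hYs]; exact ih i
  have hcoeff : ∀ m d i, PowerSeries.coeff m (Y (m + d) i) = PowerSeries.coeff m (Y m i) := by
    intro m d i
    induction d with
    | zero => rfl
    | succ d ih =>
      rw [← ih, ← sub_eq_zero, ← map_sub]
      exact PowerSeries.X_pow_dvd_iff.1 (hstep (m + d) i) m (by omega)
  -- The coefficient of `q^m` is stable from the `m`-th iterate on.
  set y : ι → PowerSeries R := fun i => PowerSeries.mk fun m => PowerSeries.coeff m (Y m i) with hy
  have hyY : ∀ m i, (PowerSeries.X : PowerSeries R) ^ (m + 1) ∣ y i - Y m i := by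
    intro m i
    rw [PowerSeries.X_pow_dvd_iff]
    intro d hd
    obtain ⟨e, rfl⟩ : ∃ e, m = d + e := ⟨m - d, by omega⟩
    rw [map_sub, hcoeff, hy, PowerSeries.coeff_mk, sub_self]
  have hyc : ∀ i, PowerSeries.constantCoeff (y i) = c i := by
    intro i
    rw [← hYc 0 i, ← sub_eq_zero, ← map_sub, ← PowerSeries.X_dvd_iff]
    simpa using hyY 0 i
  have hfix : Φ y = y := by
    refine hunique _ _ fun m i => ?_
    have h1 := hΦ _ _ _ hyc (hYc m) (hyY m) i
    have h2 := hyY (m + 1) i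
    rw [hYs] at h2
    have h3 := (dvd_sub h1 h2)
    rw [sub_sub_sub_cancel_right] at h3
    exact (pow_dvd_pow _ (by omega)).trans h3
  refine ⟨y, fun z => ⟨fun ⟨hzc, hz⟩ => ?_, fun h => h ▸ ⟨hyc, hfix⟩⟩⟩
  refine hunique _ _ fun m => ?_
  induction m with
  | zero => intro i; simp
  | succ m ih =>
    intro i
    have := hΦ m z y hzc hyc ih i
    rwa [hz, hfix] at this

end PowerSeriesFixedPoint

theorem map_inverse_of_isUnit {R S : Type*} [CommRing R] [CommRing S] (f : R →+* S) {u : R}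
    (hu : IsUnit u) : f (Ring.inverse u) = Ring.inverse (f u) := by
  obtain ⟨u, rfl⟩ := hu
  rw [Ring.inverse_unit]
  exact (Ring.inverse_unit (Units.map (f : R →* S) u)).symm

theorem map_ominus {R S : Type*} [CommRing R] [CommRing S] (f : R →+* S) {b x y : R}
    (hu : IsUnit (1 + b * y)) : f (ominus b x y) = ominus (f b) (f x) (f y) := by
  simp [ominus, map_inverse_of_isUnit f hu]

theorem map_factorialG {R S : Type*} [CommRing R] [CommRing S] (f : R →+* S) {n : ℕ} (b : R)
    (shape : Fin n → ℕ) (x : Fin n → R) (a : ℤ → R) :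
    f (factorialG b shape x a) = factorialG (f b) shape (f ∘ x) (f ∘ a) := by
  simp [factorialG, oplus]

/-! ### The Bethe equations as a fixed point problem. -/

section BetheEquations

variable {R : Type*} [CommRing R] {N : ℕ}

theorem isUnit_one_add_C_mul {b c : R} (h : IsUnit (1 + b * c)) {y : PowerSeries R}
    (hy : PowerSeries.constantCoeff y = c) : IsUnit (1 + PowerSeries.C b * y) := by
  rw [PowerSeries.isUnit_iff_constantCoeff]
  simpa [hy] using h

theorem isUnit_sub_of_constantCoeff {c d : R} (h : IsUnit (c - d)) {y z : PowerSeries R}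
    (hy : PowerSeries.constantCoeff y = c) (hz : PowerSeries.constantCoeff z = d) :
    IsUnit (y - z) := by
  rwa [PowerSeries.isUnit_iff_constantCoeff, map_sub, hy, hz]

/-- The left hand side of a Bethe equation at `y i`, up to the summand `q`, divided by
`y i - τ (a i)`. -/
def betheCofactor {A : Type*} [CommRing A] {n : ℕ} (b : A) (τ : Fin N → A) (a : Fin n → Fin N)
    (y : Fin n → A) (i : Fin n) : A :=
  (-1) ^ n * (∏ l, (1 + b * y l)) * Ring.inverse (1 + b * y i) ^ n *
    (Ring.inverse (1 + b * τ (a i)) * ∏ j ∈ Finset.univ.erase (a i), ominus b (y i) (τ j))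

theorem map_betheCofactor {A S : Type*} [CommRing A] [CommRing S] (f : A →+* S) {n : ℕ} {b : A}
    {τ : Fin N → A} {a : Fin n → Fin N} {y : Fin n → A} (hτ : ∀ j, IsUnit (1 + b * τ j))
    (hy : ∀ i, IsUnit (1 + b * y i)) (i : Fin n) :
    f (betheCofactor b τ a y i) = betheCofactor (f b) (f ∘ τ) a (f ∘ y) i := by
  simp [betheCofactor, map_inverse_of_isUnit f (hy _), map_inverse_of_isUnit f (hτ _),
    map_ominus f (hτ _)]

theorem isUnit_betheCofactor {A : Type*} [CommRing A] {n : ℕ} {b : A}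
    {τ : Fin N → A} {a : Fin n → Fin N} {y : Fin n → A} (hτ : ∀ j, IsUnit (1 + b * τ j))
    (hy : ∀ i, IsUnit (1 + b * y i)) (hyτ : ∀ i j, a i ≠ j → IsUnit (y i - τ j)) (i : Fin n) :
    IsUnit (betheCofactor b τ a y i) :=
  (((isUnit_one.neg.pow n).mul (IsUnit.prod_iff.2 fun l _ => hy l)).mul
    ((hy i).ringInverse.pow n)).mul ((hτ _).ringInverse.mul (IsUnit.prod_iff.2 fun j hj =>
      (hyτ i j (Finset.ne_of_mem_erase hj).symm).mul (hτ j).ringInverse))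

/-- The factor with `j = a i` contains `y_i - τ (a i)`, so the equation reads cofactor times `y_i -
τ (a i)` plus `q` equals 0, and the cofactor can be inverted. -/
theorem bethe_iff {A : Type*} [CommRing A] {n : ℕ} {b q : A} {τ : Fin N → A} {a : Fin n → Fin N}
    {y : Fin n → A} {i : Fin n} (hu : IsUnit (betheCofactor b τ a y i)) :
    (-1) ^ n * (∏ l, (1 + b * y l)) * Ring.inverse (1 + b * y i) ^ n *
        (∏ j, ominus b (y i) (τ j)) + q = 0 ↔
      τ (a i) - q * Ring.inverse (betheCofactor b τ a y i) = y i := by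
  have h1 : (-1) ^ n * (∏ l, (1 + b * y l)) * Ring.inverse (1 + b * y i) ^ n *
      (∏ j, ominus b (y i) (τ j)) = betheCofactor b τ a y i * (y i - τ (a i)) := by
    rw [← Finset.mul_prod_erase _ _ (Finset.mem_univ (a i)), betheCofactor]
    simp only [ominus]
    ring
  have h2 := Ring.inverse_mul_cancel _ hu
  rw [h1]
  constructor
  · intro h
    linear_combination (-Ring.inverse (betheCofactor b τ a y i)) * h + (y i - τ (a i)) * h2
  · intro h
    linear_combination (-betheCofactor b τ a y i) * h - q * h2

/-- With the prescribed constant terms every cofactor is a unit, and its inverse modulo `q^m`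
depends only on `y` modulo `q^m`. The factor `q` in front makes the fixed point map a contraction.
-/
theorem existsUnique_bethe_solution {b : R} {τ : Fin N → R} (hτ : ∀ j, IsUnit (1 + b * τ j))
    (hττ : ∀ i j, i ≠ j → IsUnit (τ i - τ j)) {n : ℕ} (a : Fin n → Fin N) :
    ∃ y : Fin n → PowerSeries R, ∀ z : Fin n → PowerSeries R,
      ((∀ i, PowerSeries.constantCoeff (z i) = τ (a i)) ∧
        ∀ i, (-1) ^ n * (∏ l, (1 + PowerSeries.C b * z l)) *
          Ring.inverse (1 + PowerSeries.C b * z i) ^ n *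
          (∏ j, ominus (PowerSeries.C b) (z i) (PowerSeries.C (τ j))) + PowerSeries.X = 0) ↔
        z = y := by
  have hτ' : ∀ j, IsUnit (1 + PowerSeries.C b * PowerSeries.C (τ j)) := fun j =>
    isUnit_one_add_C_mul (hτ j) (by simp)
  have hy : ∀ y : Fin n → PowerSeries R, (∀ i, PowerSeries.constantCoeff (y i) = τ (a i)) →
      ∀ i, IsUnit (1 + PowerSeries.C b * y i) := fun y h i => isUnit_one_add_C_mul (hτ _) (h i)
  have hu : ∀ y : Fin n → PowerSeries R, (∀ i, PowerSeries.constantCoeff (y i) = τ (a i)) →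
      ∀ i, IsUnit (betheCofactor (PowerSeries.C b) (fun j => PowerSeries.C (τ j)) a y i) :=
    fun y h => isUnit_betheCofactor hτ' (hy y h) fun i j hij =>
      isUnit_sub_of_constantCoeff (hττ _ _ hij) (h i) (by simp)
  have hΦ : ∀ (m : ℕ) (y z : Fin n → PowerSeries R),
      (∀ i, PowerSeries.constantCoeff (y i) = τ (a i)) →
      (∀ i, PowerSeries.constantCoeff (z i) = τ (a i)) →
      (∀ i, (PowerSeries.X : PowerSeries R) ^ m ∣ y i - z i) →
      ∀ i, (PowerSeries.X : PowerSeries R) ^ (m + 1) ∣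
        (PowerSeries.C (τ (a i)) - PowerSeries.X *
          Ring.inverse (betheCofactor (PowerSeries.C b) (fun j => PowerSeries.C (τ j)) a y i)) -
        (PowerSeries.C (τ (a i)) - PowerSeries.X *
          Ring.inverse (betheCofactor (PowerSeries.C b) (fun j => PowerSeries.C (τ j)) a z i)) := by
    intro m y z h1 h2 h i
    rw [sub_sub_sub_cancel_left, ← mul_sub, pow_succ']
    refine mul_dvd_mul_left _ ?_
    have h0 : Ideal.Quotient.mk (Ideal.span {(PowerSeries.X : PowerSeries R) ^ m}) ∘ y =
        Ideal.Quotient.mk _ ∘ z := funext fun i => by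
      rw [Function.comp_apply, Function.comp_apply, Ideal.Quotient.eq, Ideal.mem_span_singleton]
      exact h i
    rw [← Ideal.mem_span_singleton, ← Ideal.Quotient.eq,
      map_inverse_of_isUnit _ (hu z h2 i), map_inverse_of_isUnit _ (hu y h1 i),
      map_betheCofactor _ hτ' (hy z h2), map_betheCofactor _ hτ' (hy y h1), h0]
  obtain ⟨y, hyz⟩ := existsUnique_fixedPoint (fun i => τ (a i))
    (fun z i => PowerSeries.C (τ (a i)) - PowerSeries.X *
      Ring.inverse (betheCofactor (PowerSeries.C b) (fun j => PowerSeries.C (τ j)) a z i))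
    (fun y _ i => by simp) hΦ
  refine ⟨y, fun z => ?_⟩
  rw [← hyz]
  refine and_congr_right fun h => ?_
  rw [funext_iff]
  exact forall_congr' fun i => bethe_iff (τ := fun j => PowerSeries.C (τ j)) (hu z h i)

end BetheEquations

/-! ### Bethe roots over the equivariant coefficient ring. -/

section BetheRoots

variable {N : ℕ}

theorem isUnit_one_add_betaCoeff_mul_tCoeff (i : Fin N) :
    IsUnit (1 + betaCoeff N * tCoeff i) := by
  simpa [β, t] using (isUnit_one_add_beta_mul_t i).map (PowerSeries.constantCoeff (R := EquivRing N))

theorem isUnit_tCoeff_sub {i j : Fin N} (h : i ≠ j) :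
    IsUnit (tCoeff i - tCoeff j : EquivRing N) := by
  have h1 : (MvPolynomial.X i - MvPolynomial.X j :
      MvPolynomial (Fin N) (Polynomial ℤ)) ∈ regularDenominators N := by
    simp only [regularDenominators, Submonoid.mem_inf, Submonoid.mem_comap,
      mem_nonZeroDivisors_iff_ne_zero, specialise]
    -- At the point `t_i = 1`, all other `t` being 0, the difference is 1.
    constructor <;> intro h0 <;>
      simpa [h.symm] using congrArg (MvPolynomial.eval fun a => if a = i then (1 : ℤ) else 0) h0
  simpa [tCoeff] using
    IsLocalization.map_units (EquivRing N) (⟨_, h1⟩ : regularDenominators N)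

theorem exists_isBetheRoot_iff {n k : ℕ} (μ : BoxedPartition n k) :
    ∃ y : Fin n → QuantumRing (n + k), ∀ z, IsBetheRoot μ z ↔ z = y := by
  obtain ⟨y, hy⟩ := existsUnique_bethe_solution
    (R := EquivRing (n + k)) (b := betaCoeff (n + k)) (τ := tCoeff)
    isUnit_one_add_betaCoeff_mul_tCoeff (fun i j => isUnit_tCoeff_sub) (fun i => μ.position i)
  refine ⟨y, fun z => ?_⟩
  rw [← hy]
  exact ⟨fun h => ⟨h.constant, h.bethe⟩, fun h => ⟨h.2, h.1⟩⟩

end BetheRoots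

/-! ### Exchanging two adjacent parameters in a factorial Grothendieck polynomial. -/

section Difference

variable {A : Type*} [CommRing A] {n k : ℕ}

/-- Either `j + 1` is no exponent and the matrix is unchanged, or `j` and `j + 1` both are and the
determinant is. Only parameters of positive index enter, so `ha` need not control the others. -/
theorem factorialG_comp_swap (b : A) (p : BoxedPartition n k) {x : Fin n → A}
    (hx : ∀ i, IsUnit (1 + b * x i)) (hv : ∀ i j, i < j → IsUnit (x i - x j)) {a a' : ℤ → A}
    {j : ℕ} (hj : j + 1 < n + k)
    (ha : (fun q : ℕ => a' (q + 1)) = (fun q : ℕ => a (q + 1)) ∘ Equiv.swap j (j + 1))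
    (h : ¬((⟨j, by omega⟩ : Fin (n + k)) ∉ p.ones ∧ (⟨j + 1, hj⟩ : Fin (n + k)) ∈ p.ones)) :
    factorialG b p.part x a' = factorialG b p.part x a := by
  refine (isUnit_vandermondeProd hv).mul_left_cancel ?_
  rw [← det_powerMatrix b p.anti hx, ← det_powerMatrix b p.anti hx, ha]
  by_cases h1 : (⟨j + 1, hj⟩ : Fin (n + k)) ∈ p.ones
  · have h2 : (⟨j, by omega⟩ : Fin (n + k)) ∈ p.ones := by
      by_contra h2
      exact h ⟨h2, h1⟩
    obtain ⟨l, hl⟩ := BoxedPartition.mem_ones_iff_exponents.1 h1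
    obtain ⟨l', hl'⟩ := BoxedPartition.mem_ones_iff_exponents.1 h2
    exact det_powerMatrix_comp_swap_of_mem b (exponents_strictAnti p.anti) x _ hl hl'
  · rw [powerMatrix_comp_swap]
    exact fun l hl => h1 (BoxedPartition.mem_ones_iff_exponents.2 ⟨l, hl⟩)

theorem factorialG_comp_swap_sub (b : A) (p : BoxedPartition n k) {x : Fin n → A}
    (hx : ∀ i, IsUnit (1 + b * x i)) (hv : ∀ i j, i < j → IsUnit (x i - x j)) {a a' : ℤ → A}
    {j : ℕ} (hj : j + 1 < n + k)
    (ha : (fun q : ℕ => a' (q + 1)) = (fun q : ℕ => a (q + 1)) ∘ Equiv.swap j (j + 1))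
    (h0 : (⟨j, by omega⟩ : Fin (n + k)) ∉ p.ones)
    (h1 : (⟨j + 1, hj⟩ : Fin (n + k)) ∈ p.ones) :
    (1 + b * a (j + 1)) * (factorialG b p.part x a' - factorialG b p.part x a) =
      (a (j + 2) - a (j + 1)) *
        (b * factorialG b p.part x a + factorialG b (simpleSwap j hj • p).part x a) := by
  obtain ⟨l, hl⟩ := BoxedPartition.mem_ones_iff_exponents.1 h1
  have key := det_powerMatrix_comp_swap_of_notMem b (exponents_strictAnti p.anti) x
    (fun q : ℕ => a (q + 1)) hl
  rw [← ha, ← BoxedPartition.exponents_simpleSwap_smul hj h0 hl, det_powerMatrix b p.anti hx,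
    det_powerMatrix b p.anti hx, det_powerMatrix b (BoxedPartition.anti _) hx] at key
  rw [show ((j + 1 : ℕ) : ℤ) + 1 = (j : ℤ) + 2 by push_cast; ring] at key
  refine (isUnit_vandermondeProd hv).mul_left_cancel ?_
  linear_combination key

/-- Here `1 + b (⊖t₁) = 1 / (1 + b t₁)` and `⊖t₂ - ⊖t₁ = (t₁ ⊖ t₂) / (1 + b t₁)`; the common
denominator cancels. -/
theorem ominus_zero_relation {b t₁ t₂ d e : A} (h₁ : IsUnit (1 + b * t₁))
    (h₂ : IsUnit (1 + b * t₂))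
    (h : (1 + b * ominus b 0 t₁) * d = (ominus b 0 t₂ - ominus b 0 t₁) * e) :
    d = ominus b t₁ t₂ * e := by
  have e1 := Ring.inverse_mul_cancel _ h₁
  have e2 := Ring.inverse_mul_cancel _ h₂
  simp only [ominus] at h ⊢
  set u := Ring.inverse (1 + b * t₁)
  set v := Ring.inverse (1 + b * t₂)
  have h3 : 1 + b * ((0 - t₁) * u) = u := by linear_combination -e1
  have h4 : (0 - t₂) * v - (0 - t₁) * u = (t₁ - t₂) * v * u := by
    linear_combination t₂ * v * e1 - t₁ * u * e2
  rw [h3, h4] at h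
  linear_combination (1 + b * t₁) * h - (d - (t₁ - t₂) * v * e) * e1

end Difference

/-! ## The action of the symmetric group on Bethe roots and Schubert classes -/

section Action

variable {N : ℕ}

theorem permCoeff_tCoeff (w : Equiv.Perm (Fin N)) (i : Fin N) :
    permCoeff N w (tCoeff i) = tCoeff (w i) := by
  change IsLocalization.map (EquivRing N) _ (regularDenominators_le w) _ = _
  rw [tCoeff, IsLocalization.map_eq]
  simp [tCoeff]

theorem permCoeff_betaCoeff (w : Equiv.Perm (Fin N)) :
    permCoeff N w (betaCoeff N) = betaCoeff N := by
  change IsLocalization.map (EquivRing N) _ (regularDenominators_le w) _ = _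
  rw [betaCoeff, IsLocalization.map_eq]
  simp

theorem permSeries_t (w : Equiv.Perm (Fin N)) (i : Fin N) :
    permSeries N w (t i) = t (w i) := by
  rw [permSeries, t, PowerSeries.map_C, permCoeff_tCoeff, t]

theorem permSeries_beta (w : Equiv.Perm (Fin N)) : permSeries N w (β N) = β N := by
  rw [permSeries, β, PowerSeries.map_C, permCoeff_betaCoeff]

theorem permSeries_inverse (w : Equiv.Perm (Fin N)) {u : QuantumRing N} (hu : IsUnit u) :
    permSeries N w (Ring.inverse u) = Ring.inverse (permSeries N w u) :=
  map_inverse_of_isUnit (R := QuantumRing N) (S := QuantumRing N) (permSeries N w) hu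

theorem permSeries_ominus (w : Equiv.Perm (Fin N)) (x : QuantumRing N) {y : QuantumRing N}
    (hy : IsUnit (1 + β N * y)) :
    permSeries N w (ominus (β N) x y) =
      ominus (β N) (permSeries N w x) (permSeries N w y) :=
  (map_ominus (R := QuantumRing N) (S := QuantumRing N) (permSeries N w) hy).trans
    (by rw [permSeries_beta])

theorem permSeries_factorialG (w : Equiv.Perm (Fin N)) {n : ℕ} (shape : Fin n → ℕ)
    (x : Fin n → QuantumRing N) (a : ℤ → QuantumRing N) :
    permSeries N w (factorialG (β N) shape x a) =
      factorialG (β N) shape (permSeries N w ∘ x) (permSeries N w ∘ a) :=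
  (map_factorialG (R := QuantumRing N) (S := QuantumRing N) (permSeries N w) _ _ _ _).trans
    (by rw [permSeries_beta])

theorem constantCoeff_permSeries (w : Equiv.Perm (Fin N)) (f : QuantumRing N) :
    PowerSeries.constantCoeff (permSeries N w f) =
      permCoeff N w (PowerSeries.constantCoeff f) := by
  rw [permSeries, ← PowerSeries.coeff_zero_eq_constantCoeff_apply, PowerSeries.coeff_map,
    PowerSeries.coeff_zero_eq_constantCoeff_apply]

theorem tSeq_add_one (q : ℕ) :
    tSeq N ((q : ℤ) + 1) = if h : q < N then t ⟨q, h⟩ else 0 := by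
  unfold tSeq
  by_cases h : q < N
  · rw [dif_pos h, dif_pos (by omega)]
    congr 2
    omega
  · rw [dif_neg h, dif_neg (by omega)]

theorem permSeries_tSeq {j : ℕ} (hj : j + 1 < N) (q : ℕ) :
    permSeries N (simpleSwap j hj) (tSeq N ((q : ℤ) + 1)) =
      tSeq N ((Equiv.swap j (j + 1) q : ℕ) + 1) := by
  rw [tSeq_add_one, tSeq_add_one]
  by_cases h : q < N
  · have h1 : Equiv.swap j (j + 1) q = (simpleSwap j hj ⟨q, h⟩ : Fin N) := by
      simp only [simpleSwap, Equiv.swap_apply_def, Fin.mk.injEq]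
      split_ifs <;> rfl
    rw [dif_pos h, permSeries_t, dif_pos (by rw [h1]; exact Fin.is_lt _)]
    congr 1
    exact Fin.ext h1.symm
  · rw [dif_neg h, Equiv.swap_apply_of_ne_of_ne (by omega) (by omega), dif_neg h, map_zero]

theorem isUnit_one_add_beta_mul_tSeq (m : ℤ) : IsUnit (1 + β N * tSeq N m) := by
  unfold tSeq
  split_ifs
  · exact isUnit_one_add_beta_mul_t _
  · rw [mul_zero, add_zero]
    exact isUnit_one

variable {n k : ℕ}

theorem IsBetheRoot.isUnit_one_add {μ : BoxedPartition n k} {y : Fin n → QuantumRing (n + k)}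
    (hy : IsBetheRoot μ y) (i : Fin n) : IsUnit (1 + β (n + k) * y i) :=
  isUnit_one_add_C_mul (R := EquivRing (n + k)) (b := betaCoeff (n + k))
    (c := tCoeff (μ.position i)) (isUnit_one_add_betaCoeff_mul_tCoeff _) (hy.constant i)

theorem IsBetheRoot.isUnit_sub {μ : BoxedPartition n k} {y : Fin n → QuantumRing (n + k)}
    (hy : IsBetheRoot μ y) {i j : Fin n} (h : i < j) : IsUnit (y i - y j) :=
  isUnit_sub_of_constantCoeff (R := EquivRing (n + k)) (c := tCoeff (μ.position i))
    (d := tCoeff (μ.position j)) (isUnit_tCoeff_sub (μ.position.injective.ne h.ne))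
    (hy.constant i) (hy.constant j)

/-- The equations are symmetric in `t`, and the product over `l` is symmetric in the roots, so `w`
maps solutions to solutions; only the constant terms move. -/
theorem IsBetheRoot.permSeries {μ : BoxedPartition n k} {y : Fin n → QuantumRing (n + k)}
    (hy : IsBetheRoot μ y) (w : Equiv.Perm (Fin (n + k))) {σ : Equiv.Perm (Fin n)}
    (hσ : ∀ i, w (μ.position (σ i)) = (w • μ).position i) :
    IsBetheRoot (w • μ) fun i => permSeries (n + k) w (y (σ i)) := by
  constructor
  · intro i
    have h := congrArg (BetheGKM.permSeries (n + k) w) (hy.bethe (σ i))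
    have hX : BetheGKM.permSeries (n + k) w PowerSeries.X = PowerSeries.X := PowerSeries.map_X _
    simp only [map_add, map_mul, map_pow, map_neg, map_one, map_zero, map_prod, hX,
      permSeries_beta, permSeries_inverse w (hy.isUnit_one_add (σ i)),
      permSeries_ominus w _ (isUnit_one_add_beta_mul_t _), permSeries_t] at h
    rw [Equiv.prod_comp σ fun l => 1 + β (n + k) * BetheGKM.permSeries (n + k) w (y l)]
    rwa [Equiv.prod_comp w fun j =>
      ominus (β (n + k)) (BetheGKM.permSeries (n + k) w (y (σ i))) (t j)] at h
  · intro i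
    rw [constantCoeff_permSeries, hy.constant, permCoeff_tCoeff, hσ]

/-- By uniqueness `w` maps `y μ` to a rearrangement of `y (w • μ)`, and symmetry of `G` in `x`
removes the rearrangement. Apart from the label, `w` only affects the parameters. -/
theorem permSeries_schubertClass {y : BoxedPartition n k → Fin n → QuantumRing (n + k)}
    (hy : ∀ μ z, IsBetheRoot μ z ↔ z = y μ) (w : Equiv.Perm (Fin (n + k)))
    (p μ : BoxedPartition n k) :
    permSeries (n + k) w (schubertClass y p μ) =
      factorialG (β (n + k)) p.part (y (w • μ))
        fun m => ominus (β (n + k)) 0 (permSeries (n + k) w (tSeq (n + k) m)) := by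
  obtain ⟨σ, hσ⟩ := μ.exists_perm_position_smul w
  have hroot : ∀ μ, IsBetheRoot μ (y μ) := fun μ => (hy μ _).2 rfl
  have h1 := (hy _ _).1 ((hroot μ).permSeries w hσ)
  have h2 : permSeries (n + k) w ∘ y μ = y (w • μ) ∘ ⇑σ⁻¹ := by
    funext i
    rw [← h1]
    simp
  have h3 : (permSeries (n + k) w ∘ fun m => ominus (β (n + k)) 0 (tSeq (n + k) m)) =
      fun m => ominus (β (n + k)) 0 (permSeries (n + k) w (tSeq (n + k) m)) := by
    funext m
    rw [Function.comp_apply, permSeries_ominus w _ (isUnit_one_add_beta_mul_tSeq m), map_zero]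
  rw [schubertClass, permSeries_factorialG, h2, h3]
  exact factorialG_comp_perm _ p.anti (hroot _).isUnit_one_add
    (fun i j => (hroot _).isUnit_sub) _ _

/-- As `s_j` is an involution, the roots at `μ` come back to `y μ`; what remains is the exchange of
two parameters. -/
theorem permSeq_schubertClass_sub {y : BoxedPartition n k → Fin n → QuantumRing (n + k)}
    (hy : ∀ μ z, IsBetheRoot μ z ↔ z = y μ) {j : ℕ} (hj : j + 1 < n + k)
    (p : BoxedPartition n k) :
    permSeq n k (simpleSwap j hj) (schubertClass y p) - schubertClass y p =
      ominus (β (n + k)) (t ⟨j, by omega⟩) (t ⟨j + 1, hj⟩) • deltaStar y j hj p := by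
  have hroot : ∀ μ, IsBetheRoot μ (y μ) := fun μ => (hy μ _).2 rfl
  funext μ
  have hs : simpleSwap j hj • simpleSwap j hj • μ = μ := by
    rw [smul_smul]
    simp [simpleSwap]
  have ha : (fun q : ℕ => ominus (β (n + k)) 0
      (permSeries (n + k) (simpleSwap j hj) (tSeq (n + k) (q + 1)))) =
      (fun q : ℕ => ominus (β (n + k)) 0 (tSeq (n + k) (q + 1))) ∘ Equiv.swap j (j + 1) := by
    funext q
    rw [permSeries_tSeq, Function.comp_apply]
  rw [Pi.sub_apply, permSeq_simpleSwap_apply, permSeries_schubertClass hy, hs, Pi.smul_apply,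
    smul_eq_mul, deltaStar]
  split_ifs with h
  · have t1 : tSeq (n + k) ((j : ℤ) + 1) = t ⟨j, by omega⟩ := by
      rw [tSeq_add_one, dif_pos (by omega : j < n + k)]
    have t2 : tSeq (n + k) ((j : ℤ) + 2) = t ⟨j + 1, hj⟩ := by
      have := tSeq_add_one (N := n + k) (j + 1)
      rwa [dif_pos hj, show ((j + 1 : ℕ) : ℤ) + 1 = (j : ℤ) + 2 by push_cast; ring] at this
    have key := factorialG_comp_swap_sub (β (n + k)) p (hroot μ).isUnit_one_add
      (fun i j => (hroot μ).isUnit_sub) (a := fun m => ominus (β (n + k)) 0 (tSeq (n + k) m))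
      (a' := fun m => ominus (β (n + k)) 0
        (permSeries (n + k) (simpleSwap j hj) (tSeq (n + k) m))) hj ha h.1 h.2
    simp only [t1, t2] at key
    exact ominus_zero_relation (isUnit_one_add_beta_mul_t _) (isUnit_one_add_beta_mul_t _) key
  · rw [Pi.zero_apply, mul_zero, sub_eq_zero]
    exact factorialG_comp_swap _ p (hroot μ).isUnit_one_add
      (fun i j => (hroot μ).isUnit_sub) hj ha h

theorem permSeries_ominus_simpleSwap {j : ℕ} (hj : j + 1 < n + k) :
    permSeries (n + k) (simpleSwap j hj)
        (ominus (β (n + k)) (t ⟨j + 1, hj⟩) (t ⟨j, by omega⟩)) =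
      ominus (β (n + k)) (t ⟨j, by omega⟩) (t ⟨j + 1, hj⟩) := by
  rw [permSeries_ominus _ _ (isUnit_one_add_beta_mul_t _), permSeries_t, permSeries_t,
    simpleSwap, Equiv.swap_apply_left, Equiv.swap_apply_right]

theorem localise_mapRange_single (y : BoxedPartition n k → Fin n → QuantumRing (n + k))
    (w : Equiv.Perm (Fin (n + k))) (p : BoxedPartition n k) (f : QuantumRing (n + k)) :
    localise y ((Finsupp.single p f : SpinSpace n k).mapRange (permSeries (n + k) w)
      (map_zero _)) = permSeries (n + k) w f • schubertClass y p := by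
  rw [Finsupp.mapRange_single, localise, Finsupp.linearCombination_single]

theorem permSeq_smul (w : Equiv.Perm (Fin (n + k))) (f : QuantumRing (n + k))
    (g : BoxedPartition n k → QuantumRing (n + k)) :
    permSeq n k w (f • g) = permSeries (n + k) w f • permSeq n k w g := by
  funext μ
  exact map_mul (permSeries (n + k) w) f (g (w⁻¹ • μ))

theorem mapRange_permSeries_smul (w : Equiv.Perm (Fin (n + k))) (f : QuantumRing (n + k))
    (v : SpinSpace n k) : (f • v).mapRange (permSeries (n + k) w) (map_zero _) =
      permSeries (n + k) w f • v.mapRange (permSeries (n + k) w) (map_zero _) := by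
  ext p : 1
  exact map_mul (permSeries (n + k) w) f (v p)

theorem mapRange_permSeries_add (w : Equiv.Perm (Fin (n + k))) (v v' : SpinSpace n k) :
    (v + v').mapRange (permSeries (n + k) w) (map_zero _) =
      v.mapRange (permSeries (n + k) w) (map_zero _) +
        v'.mapRange (permSeries (n + k) w) (map_zero _) :=
  Finsupp.mapRange_add (map_add (permSeries (n + k) w)) v v'

/-- Both sides are semilinear over `s_j`, so basis vectors suffice. There `s_j` turns `t_{j+1} ⊖
t_j` into `t_j ⊖ t_{j+1}`, and the braid matrix reproduces the GKM condition. -/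
theorem localise_braidAction {y : BoxedPartition n k → Fin n → QuantumRing (n + k)}
    (hy : ∀ μ z, IsBetheRoot μ z ↔ z = y μ) {j : ℕ} (hj : j + 1 < n + k) (v : SpinSpace n k) :
    localise y (braidAction j hj v) = permSeq n k (simpleSwap j hj) (localise y v) := by
  induction v using Finsupp.induction_linear with
  | zero => simp [braidAction]
  | add v v' h h' =>
    rw [map_add, map_add, ← h, ← h', ← map_add]
    congr 1
    rw [braidAction, map_add, mapRange_permSeries_add]
    rfl
  | single p f =>
    have key : permSeq n k (simpleSwap j hj) (schubertClass y p) =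
        ominus (β (n + k)) (t ⟨j, by omega⟩) (t ⟨j + 1, hj⟩) • deltaStar y j hj p +
          schubertClass y p := by
      rw [← permSeq_schubertClass_sub hy hj p]
      funext μ
      exact (sub_add_cancel (G := QuantumRing (n + k)) _ _).symm
    rw [braidAction, braid, Finsupp.linearCombination_single, mapRange_permSeries_smul, map_smul,
      localise, Finsupp.linearCombination_single, permSeq_smul, ← localise, key, deltaStar]
    congr 1
    split_ifs with h
    · rw [mapRange_permSeries_add, map_add, localise_mapRange_single, localise_mapRange_single,
        map_add, map_mul, map_one, permSeries_beta, permSeries_ominus_simpleSwap, smul_add,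
        smul_smul, add_smul, one_smul, mul_comm (β (n + k))]
      abel
    · rw [localise_mapRange_single, map_one, one_smul, smul_zero, zero_add]

end Action

end

end BetheGKM

open BetheGKM in
theorem mainTheorem3 (n k : ℕ) :
    ∃ y : BoxedPartition n k → Fin n → QuantumRing (n + k),
      (∀ (μ : BoxedPartition n k) (z : Fin n → QuantumRing (n + k)),
        IsBetheRoot μ z ↔ z = y μ) ∧
      ∀ (j : ℕ) (hj : j + 1 < n + k),
        (∀ p : BoxedPartition n k,
          permSeq n k (simpleSwap j hj) (schubertClass y p) - schubertClass y p =
            ominus (β (n + k)) (t ⟨j, by omega⟩) (t ⟨j + 1, hj⟩) • deltaStar y j hj p) ∧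
        ∀ v : SpinSpace n k,
          localise y (braidAction j hj v) = permSeq n k (simpleSwap j hj) (localise y v) := by
  choose y hy using fun μ : BoxedPartition n k => exists_isBetheRoot_iff μ
  exact ⟨y, hy, fun j hj => ⟨permSeq_schubertClass_sub hy hj, localise_braidAction hy hj⟩⟩
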